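/- Consider monoids as algebras with an associative multiplication and a constant $1$ (the identity element). Words are elements of the free monoid over a countably infinite alphabet; in the words below $x,y,s,t,h,z_1,z_2,\dots,t_1,t_2,\dots$ are pairwise distinct letters. A monoid variety is the class of all monoids satisfying some set of identities $\mathbf u\approx\mathbf v$ between words; $\mathrm{var}\,\Sigma$ is the monoid variety given by the identity system $\Sigma$, and the dual of an identity is obtained by reading both its sides from right to left. Monoid varieties form a lattice under inclusion, and $L(\mathbf V)$ denotes the lattice of all subvarieties of the variety $\mathbf V$. Let $\mathbb N=\{1,2,\dots\}$, $\mathbb N_0=\mathbb N\cup\{0\}$, and let $S_n$ be the symmetric group on $\{1,\dots,n\}$ (for $n=0$ it has one element); write $i\pi$ for the image of $i$ under $\pi$. For $n\in\mathbb N$ and $\pi,\tau\in S_n$ put $$\mathbf w_n[\pi,\tau]=\Bigl(\prod_{i=1}^n z_it_i\Bigr)x\Bigl(\prod_{i=1}^n z_{i\pi}z_{n+i\tau}\Bigr)x\Bigl(\prod_{i=n+1}^{2n} t_iz_i\Bigr),\quad \mathbf w_n'[\pi,\tau]=\Bigl(\prod_{i=1}^n z_it_i\Bigr)x^2\Bigl(\prod_{i=1}^n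 z_{i\pi}z_{n+i\tau}\Bigr)\Bigl(\prod_{i=n+1}^{2n} t_iz_i\Bigr).$$ For $n,m,k\in\mathbb N_0$ and $\rho\in S_{n+m+k}$ put $$\mathbf c_{n,m,k}[\rho]=\Bigl(\prod_{i=1}^n z_it_i\Bigr)xyt\Bigl(\prod_{i=n+1}^{n+m} z_it_i\Bigr)x\Bigl(\prod_{i=1}^{n+m+k} z_{i\rho}\Bigr)y\Bigl(\prod_{i=n+m+1}^{n+m+k} t_iz_i\Bigr),$$ $$\mathbf c_{n,m,k}'[\rho]=\Bigl(\prod_{i=1}^n z_it_i\Bigr)yxt\Bigl(\prod_{i=n+1}^{n+m} z_it_i\Bigr)x\Bigl(\prod_{i=1}^{n+m+k} z_{i\rho}\Bigr)y\Bigl(\prod_{i=n+m+1}^{n+m+k} t_iz_i\Bigr),$$ and let $\mathbf d_{n,m,k}[\rho]$, $\mathbf d_{n,m,k}'[\rho]$ be these two words read from right to left. Write $\mathbf c_{n,m}[\rho]$, $\mathbf c_{n,m}'[\rho]$, $\mathbf d_{n,m}[\rho]$, $\mathbf d_{n,m}'[\rho]$ when $k=0$. Consider the identities $$\sigma_1: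 xysxty\approx yxsxty,\quad \sigma_2: xsytxy\approx xsytyx,\quad \sigma_3: xsxyty\approx xsyxty,$$ $$\alpha_1: xysxtxhy\approx yxsxtxhy,\quad \alpha_2: xysxtyhx\approx yxsxtyhx,\quad \alpha_3: xysytxhx\approx yxsytxhx,$$ and let $\beta_i$ be the dual of $\alpha_i$. Let $\mathbf A=\mathrm{var}\{x^2\approx x^3,\ x^2y\approx yx^2\}$ and let $\mathbf A'$ be the subvariety of $\mathbf A$ given within $\mathbf A$ by all identities $\mathbf w_n[\pi,\tau]\approx\mathbf w_n'[\pi,\tau]$ ($n\in\mathbb N$, $\pi,\tau\in S_n$) and all identities $\mathbf c_{n,m,k}[\rho]\approx\mathbf c_{n,m,k}'[\rho]$ and $\mathbf d_{n,m,k}[\rho]\approx\mathbf d_{n,m,k}'[\rho]$ ($n,m,k\in\mathbb N_0$, $\rho\in S_{n+m+k}$). For $1\le r,s\le 3$ let $\mathbf Q_{r,s}$ be the monoid variety given by $x^2\approx x^3$, $x^2y\approx yx^2$, $\sigma_3$, all $\alpha_i$ with $1\le i\le 3$, $i\ne r$, all $\beta_j$ with $1\le j\le 3$, $j\ne s$,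 and all $\mathbf c_{n,m}[\rho]\approx\mathbf c_{n,m}'[\rho]$, $\mathbf d_{n,m}[\rho]\approx\mathbf d_{n,m}'[\rho]$ with $n,m\in\mathbb N_0$, $\rho\in S_{n+m}$. Let $$\mathbf R=\mathrm{var}\{x^2\approx x^3,\ x^2y\approx yx^2,\ \sigma_1,\ \sigma_2,\ \mathbf w_n[\pi,\tau]\approx\mathbf w_n'[\pi,\tau]\mid n\in\mathbb N,\ \pi,\tau\in S_n\}.$$ **Proposition.** The lattice $L(\mathbf A')$ is distributive. Moreover, $\mathbf A'$ properly contains $\mathbf R$ and each of the varieties $\mathbf Q_{r,s}$ with $1\le r,s\le 3$. -/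

import Mathlib

universe u

namespace MonVar

/-- The countably infinite alphabet: the letters `x, y, s, t, h`, together with
`z₀, z₁, z₂, …` and `t₀, t₁, t₂, …`. -/
inductive Letter : Type
  | x : Letter
  | y : Letter
  | s : Letter
  | t : Letter
  | h : Letter
  | z : ℕ → Letter
  | ti : ℕ → Letter

/-- Words are the elements of the free monoid over the alphabet. -/
abbrev Word : Type := FreeMonoid Letter

/-- An identity `u ≈ v` is a pair of words. -/
abbrev Identity : Type := Word × Word

/-- The monoid `M` satisfies the identity `u ≈ v`: the two words take equal values under every
substitution of elements of `M` for the letters. -/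
def Satisfies (M : Type u) [Monoid M] (e : Identity) : Prop :=
  ∀ f : Letter → M, FreeMonoid.lift f e.1 = FreeMonoid.lift f e.2

/-- The identity dual to `u ≈ v`: both words are read from right to left. -/
def Identity.dual (e : Identity) : Identity := (e.1.reverse, e.2.reverse)

/-! ### Monoid varieties and their lattice -/

/-- A monoid variety: a class of monoids that consists of all monoids satisfying some set of
identities. -/
structure MonoidVariety : Type (u + 1) where
  /-- membership of a monoid in the variety -/
  Mem : ∀ (M : Type u) [Monoid M], Prop
  equational : ∃ S : Set Identity, ∀ (M : Type u) [Monoid M], Mem M ↔ ∀ e ∈ S, Satisfies M e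

/-- The variety `var S` given by a set `S` of identities. -/
def var (S : Set Identity) : MonoidVariety.{u} where
  Mem M _ := ∀ e ∈ S, Satisfies M e
  equational := ⟨S, fun _ _ => Iff.rfl⟩

namespace MonoidVariety

/-- The variety `V` satisfies the identity `e`: all its members do. -/
def Models (V : MonoidVariety.{u}) (e : Identity) : Prop :=
  ∀ (M : Type u) [Monoid M], V.Mem M → Satisfies M e

theorem ext_mem {V W : MonoidVariety.{u}}
    (H : ∀ (M : Type u) [Monoid M], V.Mem M ↔ W.Mem M) : V = W := by
  cases V with
  | mk m₁ h₁ =>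
    cases W with
    | mk m₂ h₂ =>
      have hm : m₁ = m₂ := by
        funext M inst
        exact propext (H M)
      subst hm
      rfl

/-- The intersection of two varieties. -/
def meet (V W : MonoidVariety.{u}) : MonoidVariety.{u} where
  Mem M _ := V.Mem M ∧ W.Mem M
  equational := by
    obtain ⟨S, hS⟩ := V.equational
    obtain ⟨T, hT⟩ := W.equational
    refine ⟨S ∪ T, fun M _ => ?_⟩
    rw [hS M, hT M]
    constructor
    · rintro ⟨h₁, h₂⟩ e (he | he)
      · exact h₁ e he
      · exact h₂ e he
    · intro H
      exact ⟨fun e he => H e (Or.inl he), fun e he => H e (Or.inr he)⟩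

/-- The least variety that contains two given varieties: it is given by all identities that hold
in both. -/
def join (V W : MonoidVariety.{u}) : MonoidVariety.{u} :=
  var {e | V.Models e ∧ W.Models e}

/-- The lattice of all monoid varieties, ordered by inclusion. -/
instance : Lattice MonoidVariety.{u} where
  le V W := ∀ (M : Type u) [Monoid M], V.Mem M → W.Mem M
  le_refl _ _ _ := id
  le_trans _ _ _ h₁ h₂ M _ hM := h₂ M (h₁ M hM)
  le_antisymm _ _ h₁ h₂ := ext_mem fun M _ => ⟨h₁ M, h₂ M⟩
  inf := meet
  inf_le_left _ _ _ _ h := h.1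
  inf_le_right _ _ _ _ h := h.2
  le_inf _ _ _ h₁ h₂ M _ h := ⟨h₁ M h, h₂ M h⟩
  sup := join
  le_sup_left _ _ M _ h := fun _ he => he.1 M h
  le_sup_right _ _ M _ h := fun _ he => he.2 M h
  sup_le V₁ V₂ W h₁ h₂ M _ h := by
    obtain ⟨S, hS⟩ := W.equational
    rw [hS M]
    intro e he
    exact h e ⟨fun N _ hN => (hS N).1 (h₁ N hN) e he, fun N _ hN => (hS N).1 (h₂ N hN) e he⟩

/-- The variety given within the variety `V` by a set `S` of identities. -/
def within (V : MonoidVariety.{u}) (S : Set Identity) : MonoidVariety.{u} := V ⊓ var S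

/-- The lattice of all subvarieties of the variety `V`. -/
abbrev Sub (V : MonoidVariety.{u}) : Type (u + 1) := Set.Iic V

end MonoidVariety

/-! ### The words and identities -/

/-! The letters, as words of length one. -/

def x : Word := FreeMonoid.of Letter.x
def y : Word := FreeMonoid.of Letter.y
def s : Word := FreeMonoid.of Letter.s
def t : Word := FreeMonoid.of Letter.t
def h : Word := FreeMonoid.of Letter.h
def z (i : ℕ) : Word := FreeMonoid.of (Letter.z i)
def ti (i : ℕ) : Word := FreeMonoid.of (Letter.ti i)

/-- The product `u 0 * u 1 * ⋯ * u (n - 1)` of words, in this order. -/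
def wprod {n : ℕ} (u : Fin n → Word) : Word := (List.ofFn u).prod

/-- `w_n[π,τ]`. Indices of letters start with `0` here, so that the letters with indices
`0, …, n - 1` stand for those with indices `1, …, n`. -/
def w (n : ℕ) (π τ : Equiv.Perm (Fin n)) : Word :=
  wprod (fun i : Fin n => z i * ti i) * x * wprod (fun i : Fin n => z (π i) * z (n + τ i)) * x *
    wprod (fun i : Fin n => ti (n + i) * z (n + i))

/-- `w_n'[π,τ]` -/
def w' (n : ℕ) (π τ : Equiv.Perm (Fin n)) : Word :=
  wprod (fun i : Fin n => z i * ti i) * x ^ 2 * wprod (fun i : Fin n => z (π i) * z (n + τ i)) *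
    wprod (fun i : Fin n => ti (n + i) * z (n + i))

/-- `c_{n,m,k}[ρ]` -/
def c (n m k : ℕ) (ρ : Equiv.Perm (Fin (n + m + k))) : Word :=
  wprod (fun i : Fin n => z i * ti i) * x * y * t *
    wprod (fun i : Fin m => z (n + i) * ti (n + i)) * x *
    wprod (fun i : Fin (n + m + k) => z (ρ i)) * y *
    wprod (fun i : Fin k => ti (n + m + i) * z (n + m + i))

/-- `c_{n,m,k}'[ρ]` -/
def c' (n m k : ℕ) (ρ : Equiv.Perm (Fin (n + m + k))) : Word :=
  wprod (fun i : Fin n => z i * ti i) * y * x * t *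
    wprod (fun i : Fin m => z (n + i) * ti (n + i)) * x *
    wprod (fun i : Fin (n + m + k) => z (ρ i)) * y *
    wprod (fun i : Fin k => ti (n + m + i) * z (n + m + i))

/-- `c_{n,m}[ρ]` -/
def c₂ (n m : ℕ) (ρ : Equiv.Perm (Fin (n + m))) : Word :=
  wprod (fun i : Fin n => z i * ti i) * x * y * t *
    wprod (fun i : Fin m => z (n + i) * ti (n + i)) * x *
    wprod (fun i : Fin (n + m) => z (ρ i)) * y

/-- `c_{n,m}'[ρ]` -/
def c₂' (n m : ℕ) (ρ : Equiv.Perm (Fin (n + m))) : Word :=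
  wprod (fun i : Fin n => z i * ti i) * y * x * t *
    wprod (fun i : Fin m => z (n + i) * ti (n + i)) * x *
    wprod (fun i : Fin (n + m) => z (ρ i)) * y

/-- All identities `w_n[π,τ] ≈ w_n'[π,τ]` with `n ≥ 1`. -/
def wIdentities : Set Identity :=
  {e | ∃ (n : ℕ) (π τ : Equiv.Perm (Fin n)), 1 ≤ n ∧ e = (w n π τ, w' n π τ)}

/-- All identities `c_{n,m,k}[ρ] ≈ c_{n,m,k}'[ρ]`. -/
def cIdentities : Set Identity :=
  {e | ∃ (n m k : ℕ) (ρ : Equiv.Perm (Fin (n + m + k))), e = (c n m k ρ, c' n m k ρ)}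

/-- All identities `d_{n,m,k}[ρ] ≈ d_{n,m,k}'[ρ]`, the duals of the previous ones. -/
def dIdentities : Set Identity := Identity.dual '' cIdentities

/-- All identities `c_{n,m}[ρ] ≈ c_{n,m}'[ρ]`. -/
def c₂Identities : Set Identity :=
  {e | ∃ (n m : ℕ) (ρ : Equiv.Perm (Fin (n + m))), e = (c₂ n m ρ, c₂' n m ρ)}

/-- All identities `d_{n,m}[ρ] ≈ d_{n,m}'[ρ]`, the duals of the previous ones. -/
def d₂Identities : Set Identity := Identity.dual '' c₂Identities

/-- `x² ≈ x³` and `x²y ≈ yx²` -/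
def aIdentities : Set Identity := {(x ^ 2, x ^ 3), (x ^ 2 * y, y * x ^ 2)}

/-- `σ₁ : xysxty ≈ yxsxty` -/
def sigma₁ : Identity := (x * y * s * x * t * y, y * x * s * x * t * y)

/-- `σ₂ : xsytxy ≈ xsytyx` -/
def sigma₂ : Identity := (x * s * y * t * x * y, x * s * y * t * y * x)

/-- `σ₃ : xsxyty ≈ xsyxty` -/
def sigma₃ : Identity := (x * s * x * y * t * y, x * s * y * x * t * y)

/-- `α₁ : xysxtxhy ≈ yxsxtxhy`, `α₂ : xysxtyhx ≈ yxsxtyhx`, `α₃ : xysytxhx ≈ yxsytxhx`;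
here `alpha i` is `α_{i+1}`. -/
def alpha : Fin 3 → Identity :=
  ![(x * y * s * x * t * x * h * y, y * x * s * x * t * x * h * y),
    (x * y * s * x * t * y * h * x, y * x * s * x * t * y * h * x),
    (x * y * s * y * t * x * h * x, y * x * s * y * t * x * h * x)]

/-- `β_i`, the identity dual to `α_i`. -/
def beta (i : Fin 3) : Identity := (alpha i).dual

/-! ### The varieties -/

/-- `A = var {x² ≈ x³, x²y ≈ yx²}` -/
def A : MonoidVariety.{u} := var aIdentities

/-- `A* = A {w_n[π,τ] ≈ w_n'[π,τ]}` -/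
def AStar : MonoidVariety.{u} := A.within wIdentities

/-- `A' = A* {c_{n,m,k}[ρ] ≈ c_{n,m,k}'[ρ], d_{n,m,k}[ρ] ≈ d_{n,m,k}'[ρ]}` -/
def A' : MonoidVariety.{u} := AStar.within (cIdentities ∪ dIdentities)

/-- `Q_{r,s}`; here `Q r s'` with `r s' : Fin 3` is the variety with the indices `r + 1` and
`s' + 1`. -/
def Q (r s' : Fin 3) : MonoidVariety.{u} :=
  var (aIdentities ∪ {sigma₃} ∪ alpha '' {i | i ≠ r} ∪ beta '' {j | j ≠ s'} ∪
    c₂Identities ∪ d₂Identities)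

/-- `R` -/
def R : MonoidVariety.{u} := var (aIdentities ∪ {sigma₁, sigma₂} ∪ wIdentities)

end MonVar

/-! Call a congruence good if it is fully invariant and contains the identities of `A'`; the
equational theories of subvarieties of `A'` are good. A pair (u, v) is prime if in every good
congruence any proper identity u ≈ w entails u ≈ v.

Distributivity is a formal consequence of there being enough prime pairs. A derivation of a prime u
≈ v from the identities of V and of W has a first step that leaves u; it is an identity of V or of
W, so V or W alone satisfies u ≈ v (`rel_or_rel_of_prime`). Hence on prime pairs meets of varieties
act as disjunctions, joins act as conjunctions, and the distributive law becomes the propositional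
one (`inf_sup_le`).

The work lies in `le_of_prime`: if ψ contains every prime pair of φ, then ψ contains φ. The prime
pairs needed are powers of one letter against its square, ab against ba, collection of all
occurrences of x in a word whose other letters are simple (occur once), and the swap of a and c in a
word where they are adjacent only once. Given p φ q, a letter whose occurrences can all be collected
in p modulo ψ can be collected in q too; it is deleted, and induction on length applies. If no
repeated letter can be collected, p and q agree on the position of each letter among the simple
ones, and q is sorted into p by swaps of adjacent repeated letters. Each swap is either an exchange
law of good congruences or a substitution instance of a prime swap (`swap_of_ne`).

The inclusions in `A'` come from deriving the w, c and d identities from σ₁ and σ₂, respectively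
from σ₃ and the shorter c and d identities. They are proper because xysxty and xsxyty, the left
sides of σ₁ and σ₃, are isoterms for `A'`, as the Rees quotient monoids of their factors show. -/

namespace MonVar

/-! ### Combinatorics of words: restrictions, first differences, adjacent letters. -/

section ListLemmas

variable {α : Type*}

theorem exists_adjacent_of_not_isChain {R : α → α → Prop} {l : List α} (H : ¬ l.IsChain R) :
    ∃ l₁ i j l₂, l = l₁ ++ i :: j :: l₂ ∧ ¬ R i j := by
  rw [List.isChain_iff_forall_rel_of_append_cons_cons] at H
  push Not at H
  obtain ⟨a, b, l₁, l₂, h₁, h₂⟩ := H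
  exact ⟨l₁, a, b, l₂, h₁, h₂⟩

theorem filter_eq_append_pair {P : α → Bool} {p l₁ l₂ : List α} {i j : α}
    (H : p.filter P = l₁ ++ i :: j :: l₂) :
    ∃ n₁ n₂ n₃, p = n₁ ++ i :: (n₂ ++ j :: n₃) ∧ n₁.filter P = l₁ ∧ n₃.filter P = l₂ ∧
      (∀ a ∈ n₂, P a = false) ∧ P i = true ∧ P j = true := by
  obtain ⟨q₁, q₂, rfl, h₁, h₂⟩ := List.filter_eq_append_iff.1 H
  obtain ⟨r₁, r₂, rfl, h₃, h₄, h₅⟩ := List.filter_eq_cons_iff.1 h₂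
  obtain ⟨s₁, s₂, rfl, h₆, h₇, h₈⟩ := List.filter_eq_cons_iff.1 h₅
  refine ⟨q₁ ++ r₁, s₁, s₂, by simp, ?_, h₈, by simpa using h₆, h₄, h₇⟩
  simp only [List.filter_append, h₁, List.append_right_eq_self, List.filter_eq_nil_iff]
  simpa using h₃

theorem exists_head?_ne_of_ne [DecidableEq α] : ∀ {u w : List α}, u ≠ w →
    ∃ r u' w', u = r ++ u' ∧ w = r ++ w' ∧ u'.head? ≠ w'.head?
  | [], [], H => absurd rfl H
  | [], b :: w, _ => ⟨[], [], b :: w, rfl, rfl, by simp⟩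
  | a :: u, [], _ => ⟨[], a :: u, [], rfl, rfl, by simp⟩
  | a :: u, b :: w, H => by
    by_cases hab : a = b
    · subst hab
      obtain ⟨r, u', w', e₁, e₂, e₃⟩ := exists_head?_ne_of_ne (u := u) (w := w) (by simpa using H)
      exact ⟨a :: r, u', w', by simp [e₁], by simp [e₂], e₃⟩
    · exact ⟨[], a :: u, b :: w, rfl, rfl, by simpa using hab⟩

theorem filter_eq_flatMap (P : α → Bool) (p : List α) :
    p.filter P = p.flatMap fun a => if P a then [a] else [] := by
  induction p with
  | nil => rfl
  | cons a p ih => by_cases h : P a <;> simp [h, ih]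

theorem flatMap_eq_self {f : α → List α} {p : List α} (H : ∀ a ∈ p, f a = [a]) :
    p.flatMap f = p := by
  induction p with
  | nil => rfl
  | cons a p ih => simp [H a (by simp), ih fun b hb => H b (by simp [hb])]

theorem exists_repeat_of_not_nodup : ∀ {r : List α}, ¬ r.Nodup →
    ∃ r₁ a r₂ r₃, r = r₁ ++ a :: (r₂ ++ a :: r₃)
  | [], H => absurd List.nodup_nil H
  | a :: r, H => by
    by_cases ha : a ∈ r
    · obtain ⟨r₂, r₃, rfl⟩ := List.append_of_mem ha
      exact ⟨[], a, r₂, r₃, rfl⟩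
    · obtain ⟨r₁, b, r₂, r₃, e⟩ := exists_repeat_of_not_nodup
        (r := r) fun h => H (List.nodup_cons.2 ⟨ha, h⟩)
      exact ⟨a :: r₁, b, r₂, r₃, by simp [e]⟩

/-- A word is obtained from its restriction to the letters in `P` by a substitution that enlarges
the letters in `S`, if consecutive letters outside of `S` do not occur in the restriction. -/
theorem exists_flatMap_filter [DecidableEq α] (P S : α → Bool) (hSP : ∀ a, S a → P a)
    (p : List α) (hn : (p.filter S).Nodup)
    (hc : (p.filter P).IsChain fun i j => S i ∨ S j) :
    ∃ g f k, p = g ++ (p.filter P).flatMap f ++ k ∧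
      (∀ a, (a ∉ p ∨ S a = false) → f a = [a]) ∧
      (∀ a ∈ (p.filter P).head?, S a → g = []) ∧
      (∀ a ∈ (p.filter P).getLast?, S a → k = []) := by
  induction p with
  | nil => exact ⟨[], fun a => [a], [], by simp⟩
  | cons c p ih =>
    have hn' : (p.filter S).Nodup := by
      by_cases hS : S c
      · rw [List.filter_cons_of_pos hS] at hn; exact (List.nodup_cons.1 hn).2
      · rwa [List.filter_cons_of_neg hS] at hn
    by_cases hP : P c
    swap
    · have hS : S c = false := by
        by_contra hS; exact hP (hSP c (by simpa using hS))
      rw [List.filter_cons_of_neg hP] at hc ⊢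
      obtain ⟨g, f, k, e, h₁, h₂, h₃⟩ := ih hn' hc
      by_cases hhd : ∃ a ∈ (p.filter P).head?, S a
      · obtain ⟨t, ht, hSt⟩ := hhd
        obtain ⟨v, hv⟩ : ∃ v, p.filter P = t :: v := by
          cases hq : p.filter P with
          | nil => simp [hq] at ht
          | cons b v => simp [hq] at ht; exact ⟨v, by rw [ht]⟩
        have hg := h₂ t ht hSt
        subst hg
        have htv : t ∉ v := by
          have : (p.filter S) = (t :: v).filter S := by
            rw [← hv, List.filter_filter]
            apply List.filter_congr
            intro a _
            by_cases ha : S a <;> simp [ha, hSP]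
          rw [this, List.filter_cons_of_pos hSt] at hn'
          intro hm
          exact (List.nodup_cons.1 hn').1 (List.mem_filter.2 ⟨hm, hSt⟩)
        refine ⟨[], fun a => if a = t then c :: f t else f a, k, ?_, ?_, by simp, h₃⟩
        · rw [hv] at e ⊢
          have : v.flatMap (fun a => if a = t then c :: f t else f a) = v.flatMap f := by
            rw [List.flatMap_def, List.flatMap_def]
            congr 1
            apply List.map_congr_left
            intro a ha
            rw [if_neg]
            rintro rfl; exact htv ha
          simp only [List.flatMap_cons, this, if_true]
          conv_lhs => rw [e]
          simp
        · intro a ha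
          have hat : a ≠ t := by
            rintro rfl
            rcases ha with ha | ha
            · apply ha
              have : a ∈ p.filter P := by rw [hv]; simp
              simp [(List.mem_filter.1 this).1]
            · simp [hSt] at ha
          simp only [hat, if_false]
          exact h₁ a (ha.imp (fun h h' => h (by simp [h'])) id)
      · refine ⟨c :: g, f, k, ?_, ?_, ?_, h₃⟩
        · conv_lhs => rw [e]
          simp
        · intro a ha
          exact h₁ a (ha.imp (fun h h' => h (by simp [h'])) id)
        · intro a ha hS'
          exact absurd ⟨a, ha, hS'⟩ hhd
    · rw [List.filter_cons_of_pos hP] at hc ⊢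
      have hc' := hc.tail
      simp only [List.tail_cons] at hc'
      obtain ⟨g, f, k, e, h₁, h₂, h₃⟩ := ih hn' hc'
      by_cases hS : S c
      · have hcp : c ∉ p := by
          rw [List.filter_cons_of_pos hS] at hn
          intro hm
          exact (List.nodup_cons.1 hn).1 (List.mem_filter.2 ⟨hm, hS⟩)
        have hfl : ∀ X : List α, (p.filter P).flatMap (fun a => if a = c then X else f a) =
            (p.filter P).flatMap f := by
          intro X
          rw [List.flatMap_def, List.flatMap_def]
          congr 1
          apply List.map_congr_left
          intro a ha
          rw [if_neg]
          rintro rfl; exact hcp (List.mem_filter.1 ha).1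
        by_cases hq : p.filter P = []
        -- A last kept letter from `S` swallows the whole tail, so that `k` is empty.
        · refine ⟨[], fun a => if a = c then c :: p else f a, [], ?_, ?_, by simp, by simp⟩
          · simp [hq]
          · intro a ha
            have hac : a ≠ c := by
              rintro rfl
              rcases ha with ha | ha
              · simp at ha
              · simp [hS] at ha
            simp only [hac, if_false]
            exact h₁ a (ha.imp (fun h h' => h (by simp [h'])) id)
        · refine ⟨[], fun a => if a = c then c :: g else f a, k, ?_, ?_, by simp, ?_⟩
          · rw [List.flatMap_cons, hfl]
            simp only [if_true, List.nil_append, List.cons_append]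
            rw [List.append_assoc] at e
            rw [List.append_assoc, ← e]
          · intro a ha
            have hac : a ≠ c := by
              rintro rfl
              rcases ha with ha | ha
              · simp at ha
              · simp [hS] at ha
            simp only [hac, if_false]
            exact h₁ a (ha.imp (fun h h' => h (by simp [h'])) id)
          · intro a ha hSa
            refine h₃ a ?_ hSa
            rwa [List.getLast?_cons_of_ne_nil hq] at ha
      · have hS' : S c = false := by simpa using hS
        cases hq : p.filter P with
        | nil =>
          refine ⟨[], fun a => [a], p, by simp, by simp, by simp, ?_⟩
          intro a ha hSa
          simp at ha
          subst ha
          exact absurd hSa hS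
        | cons t v =>
          have hg : g = [] := by
            apply h₂ t (by simp [hq])
            rw [hq] at hc
            have := (List.isChain_cons_cons.1 hc).1
            exact this.resolve_left hS
          subst hg
          refine ⟨[], f, k, ?_, ?_, by simp, ?_⟩
          · rw [hq] at e
            rw [List.flatMap_cons, h₁ c (Or.inr hS')]
            conv_lhs => rw [e]
            simp
          · intro a ha
            exact h₁ a (ha.imp (fun h h' => h (by simp [h'])) id)
          · intro a ha hSa
            refine h₃ a ?_ hSa
            rw [hq]
            rwa [List.getLast?_cons_of_ne_nil (by simp)] at ha

theorem exists_flatMap_filter_left [DecidableEq α] (P S : α → Bool) (hSP : ∀ a, S a → P a)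
    (p : List α) (hn : (p.filter S).Nodup) (hc : (p.filter P).IsChain fun i j => S i ∨ S j)
    (hd : ∀ a ∈ (p.filter P).head?, S a) :
    ∃ f k, p = (p.filter P).flatMap f ++ k ∧ ∀ a, (a ∉ p ∨ S a = false) → f a = [a] := by
  obtain ⟨g, f, k, e, h₁, h₂, -⟩ := exists_flatMap_filter P S hSP p hn hc
  cases hq : p.filter P with
  | nil => exact ⟨fun a => [a], p, rfl, fun _ _ => rfl⟩
  | cons t v =>
    have hg := h₂ t (by simp [hq]) (hd t (by simp [hq]))
    subst hg
    exact ⟨f, k, by rw [← hq]; exact e, h₁⟩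

theorem exists_flatMap_filter_right [DecidableEq α] (P S : α → Bool) (hSP : ∀ a, S a → P a)
    (p : List α) (hn : (p.filter S).Nodup) (hc : (p.filter P).IsChain fun i j => S i ∨ S j)
    (hd : ∀ a ∈ (p.filter P).getLast?, S a) :
    ∃ g f, p = g ++ (p.filter P).flatMap f ∧ ∀ a, (a ∉ p ∨ S a = false) → f a = [a] := by
  obtain ⟨g, f, k, e, h₁, -, h₂⟩ := exists_flatMap_filter P S hSP p hn hc
  by_cases hq : p.filter P = []
  · exact ⟨p, fun a => [a], by simp [hq], fun _ _ => rfl⟩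
  · have ht := List.getLast?_eq_some_getLast hq
    have hk := h₂ _ ht (hd _ ht)
    subst hk
    exact ⟨g, f, by simpa using e, h₁⟩

/-- Where the words first differ, a letter outside {a, c} would survive both deletions while the
letter opposite survives at least one, so the two would coincide. Comparing one letter further puts
the next letter of `u` in {a, c} as well. -/
theorem exists_adjacent_pair_of_filter_eq [DecidableEq α] {a c : α} (hac : a ≠ c) {u w : List α}
    (ha : u.filter (· != a) = w.filter (· != a)) (hc : u.filter (· != c) = w.filter (· != c))
    (hne : u ≠ w) :
    ∃ r h k u' h' w', u = r ++ h :: k :: u' ∧ w = r ++ h' :: w' ∧ (h = a ∨ h = c) ∧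
      (k = a ∨ k = c) ∧ (h' = a ∨ h' = c) ∧ h' ≠ h := by
  obtain ⟨r, u₁, w₁, rfl, rfl, hd⟩ := exists_head?_ne_of_ne hne
  simp only [List.filter_append, List.append_cancel_left_eq] at ha hc
  have key : ∀ (u w : List α) (h : α), u.filter (· != a) = w.filter (· != a) →
      u.filter (· != c) = w.filter (· != c) → u.head? = some h → w.head? ≠ some h →
      h = a ∨ h = c := by
    intro u w h ha hc hu hw
    by_contra! hh
    obtain ⟨h₁, h₂⟩ := hh
    cases u with
    | nil => simp at hu
    | cons b u =>
      simp at hu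
      subst hu
      cases w with
      | nil => simp [h₁] at ha
      | cons d w =>
        simp only [List.head?_cons, ne_eq, Option.some.injEq] at hw
        by_cases hda : d = a
        · subst hda
          simp [hac, h₂] at hc
          exact hw hc.1.symm
        · simp [hda, h₁] at ha
          exact hw ha.1.symm
  cases u₁ with
  | nil =>
    cases w₁ with
    | nil => simp at hd
    | cons d w =>
      rcases key (d :: w) [] d ha.symm hc.symm rfl (by simp) with rfl | rfl
      · simp [hac] at hc
      · simp [hac.symm] at ha
  | cons h u' =>
    have hh := key (h :: u') w₁ h ha hc rfl (fun H => hd (by simp [H]))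
    cases w₁ with
    | nil =>
      rcases hh with rfl | rfl
      · simp [hac] at hc
      · simp [hac.symm] at ha
    | cons h' w' =>
      have hh' := key (h' :: w') (h :: u') h' ha.symm hc.symm rfl (fun H => hd (by simp at H ⊢; exact H))
      have hne' : h' ≠ h := fun H => hd (by simp [H])
      cases u' with
      | nil =>
        exfalso
        rcases hh with rfl | rfl <;> rcases hh' with rfl | rfl <;> simp_all
      | cons k u' =>
        refine ⟨r, h, k, u', h', w', rfl, rfl, hh, ?_, hh', hne'⟩
        by_contra! hk
        obtain ⟨k₁, k₂⟩ := hk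
        rcases hh with rfl | rfl <;> rcases hh' with rfl | rfl <;> simp_all

/-- The two chain conditions leave only the junction of `m₁ ++ [c]` and `a :: m₂` as a place for a
pair violating `R`. -/
theorem eq_of_adjacent_pair_unique {R : α → α → Prop} {m₁ m₂ r u' : List α} {c a h k : α}
    (h₁ : (m₁ ++ [c]).IsChain R) (h₂ : (a :: m₂).IsChain R) (hk : ¬ R h k)
    (H : m₁ ++ c :: a :: m₂ = r ++ h :: k :: u') : r = m₁ ∧ h = c := by
  rcases List.append_eq_append_iff.1 H with ⟨d, rfl, e⟩ | ⟨d, rfl, e⟩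
  · match d, e with
    | [], e => simp at e; simp [e.1]
    | [_], e =>
      simp at e
      rw [e.2.1, e.2.2] at h₂
      exact absurd (List.isChain_cons_cons.1 h₂).1 hk
    | _ :: b :: d, e =>
      simp at e
      rw [e.2.1, e.2.2, ← List.cons_append, List.isChain_append_cons_cons] at h₂
      exact absurd h₂.2.1 hk
  · match d, e with
    | [], e => simp at e; simp [e.1]
    | [_], e =>
      simp at e
      rw [← e.1, ← e.2.1, List.append_assoc] at h₁
      simp only [List.cons_append, List.nil_append, List.isChain_append_cons_cons] at h₁
      exact absurd h₁.2.1 hk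
    | _ :: b :: d, e =>
      simp at e
      rw [← e.1, ← e.2.1, List.append_assoc] at h₁
      simp only [List.cons_append, List.isChain_append_cons_cons] at h₁
      exact absurd h₁.2.1 hk

/-- Two words with the same projections, the first of which has only one pair of adjacent letters
from `{a, c}`, coincide up to the order of this pair. -/
theorem eq_swap_of_filter_eq [DecidableEq α] {a c : α} (hac : a ≠ c) {m₁ m₂ w : List α}
    (h₁ : (m₁ ++ [c]).IsChain fun i j => (i ≠ a ∧ i ≠ c) ∨ (j ≠ a ∧ j ≠ c))
    (h₂ : (a :: m₂).IsChain fun i j => (i ≠ a ∧ i ≠ c) ∨ (j ≠ a ∧ j ≠ c))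
    (ha : (m₁ ++ c :: a :: m₂).filter (· != a) = w.filter (· != a))
    (hc : (m₁ ++ c :: a :: m₂).filter (· != c) = w.filter (· != c))
    (hne : m₁ ++ c :: a :: m₂ ≠ w) : w = m₁ ++ a :: c :: m₂ := by
  by_contra hw
  obtain ⟨r, h, k, u', h', w', e, e', hh, hk, hh', hd⟩ :=
    exists_adjacent_pair_of_filter_eq hac ha hc hne
  obtain ⟨rfl, rfl⟩ := eq_of_adjacent_pair_unique h₁ h₂ (by grind) e
  -- The swapped word has the same projections and its only bad pair at the same place. If it also
  -- differed from `w`, the letter of `w` there would be from the pair and yet different from both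
  -- members.
  obtain ⟨r₂, b₂, k₂, u₂, b₂', w₂, e₂, e₂', hh₂, hk₂, hh₂', hd₂⟩ :=
    exists_adjacent_pair_of_filter_eq (u := r ++ a :: h :: m₂) (w := w) hac
      (by rw [← ha]; simp [hac.symm]) (by rw [← hc]; simp [hac]) (Ne.symm hw)
  have := eq_of_adjacent_pair_unique (R := fun i j => (i ≠ a ∧ i ≠ h) ∨ (j ≠ a ∧ j ≠ h))
    (m₁ := r) (c := a) (a := h) (m₂ := m₂) (by
      rw [List.isChain_append] at h₁ ⊢
      refine ⟨h₁.1, List.IsChain.singleton _, ?_⟩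
      have := h₁.2.2
      simp at this ⊢
      exact this) (by
      rw [List.isChain_cons] at h₂ ⊢
      refine ⟨?_, h₂.2⟩
      have := h₂.1
      simp at this ⊢
      exact this) (by grind) e₂
  obtain ⟨rfl, rfl⟩ := this
  rw [e'] at e₂'
  simp at e₂'
  grind

theorem isChain_of_notMem {x : α} {l : List α} (H : x ∉ l) :
    l.IsChain fun i j => i ≠ x ∨ j ≠ x := by
  rw [List.isChain_iff_forall_rel_of_append_cons_cons]
  rintro a b l₁ l₂ rfl
  left; rintro rfl; simp at H

theorem isChain_append_singleton_of_notMem {x : α} {l : List α} (H : x ∉ l) :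
    (l ++ [x]).IsChain fun i j => i ≠ x ∨ j ≠ x := by
  rw [List.isChain_append]
  refine ⟨isChain_of_notMem H, List.IsChain.singleton _, fun y hy _ _ => Or.inl ?_⟩
  rintro rfl
  exact H (List.mem_of_getLast? hy)

theorem isChain_insert {x : α} {A s B : List α} (hs : x ∉ s) (hs' : s ≠ [])
    (hA : (A ++ [x]).IsChain fun i j => i ≠ x ∨ j ≠ x)
    (hB : (x :: B).IsChain fun i j => i ≠ x ∨ j ≠ x) :
    (A ++ x :: (s ++ x :: B)).IsChain fun i j => i ≠ x ∨ j ≠ x := by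
  rw [List.isChain_split]
  refine ⟨hA, ?_⟩
  rw [List.isChain_cons_split]
  refine ⟨?_, hB⟩
  rw [List.isChain_cons, List.isChain_append]
  refine ⟨?_, isChain_of_notMem hs, List.IsChain.singleton _, ?_⟩
  · intro y hy
    cases s with
    | nil => exact absurd rfl hs'
    | cons b s => simp at hy; subst hy; right; rintro rfl; simp at hs
  · intro y hy _ _
    left; rintro rfl
    exact hs (List.mem_of_getLast? hy)

/-- If `x` occurs in the common prefix, deleting the letters after its last occurrence there makes
two x's adjacent in the first word only. Otherwise let s₂ be the gap after the first `x` in the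
first word, and s₄, s₅ the letters of the second word after `r` up to its first `x` and up to its
second. Without `x` the words agree, so s₂ and s₄s₅ are comparable as prefixes: if s₄s₅ is a prefix
of s₂, delete s₅, and if it is strictly longer, delete s₂. The gap of the other word keeps a letter.
-/
theorem exists_filter_separating_aux [DecidableEq α] {x : α} {r u' w₁ : List α}
    (hn : ((r ++ x :: u').filter (· != x)).Nodup)
    (he : u'.filter (· != x) = w₁.filter (· != x))
    (hu : (r ++ x :: u').IsChain fun i j => i ≠ x ∨ j ≠ x)
    (hw : (r ++ w₁).IsChain fun i j => i ≠ x ∨ j ≠ x)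
    (hd : w₁.head? ≠ some x) (hxu : 2 ≤ (r ++ x :: u').count x) (hxw : 2 ≤ (r ++ w₁).count x) :
    ∃ P : α → Bool, P x ∧
      ((((r ++ x :: u').filter P).IsChain (fun i j => i ≠ x ∨ j ≠ x) ∧
          ∃ l₁ l₂, (r ++ w₁).filter P = l₁ ++ x :: x :: l₂) ∨
        (((r ++ w₁).filter P).IsChain (fun i j => i ≠ x ∨ j ≠ x) ∧
          ∃ l₁ l₂, (r ++ x :: u').filter P = l₁ ++ x :: x :: l₂)) := by
  by_cases hxr : x ∈ r
  · obtain ⟨s', r', e, hs'⟩ := List.eq_append_cons_of_mem (List.mem_reverse.2 hxr)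
    obtain ⟨r₁, s₁, rfl, hs₁⟩ : ∃ r₁ s₁, r = r₁ ++ x :: s₁ ∧ x ∉ s₁ := by
      refine ⟨r'.reverse, s'.reverse, ?_, by simpa using hs'⟩
      rw [← List.reverse_reverse r, e]; simp
    refine ⟨fun b => decide (b ∉ s₁), by simpa using hs₁, Or.inr ⟨?_, ?_⟩⟩
    · have hsf : s₁.filter (fun b => decide (b ∉ s₁)) = [] := by
        rw [List.filter_eq_nil_iff]; intro a ha; simpa using ha
      have hsx : s₁.filter (· != x) = s₁ := by
        rw [List.filter_eq_self]; intro a ha; simp; rintro rfl; exact hs₁ ha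
      have hr₁ : r₁.filter (fun b => decide (b ∉ s₁)) = r₁ := by
        rw [List.filter_eq_self]; intro a ha
        simp only [decide_eq_true_eq]
        intro ha'
        have hax : a ≠ x := by rintro rfl; exact hs₁ ha'
        simp only [List.filter_append, List.append_assoc, List.filter_cons, bne_self_eq_false, hsx] at hn
        exact List.disjoint_of_nodup_append hn (List.mem_filter.2 ⟨ha, by simpa using hax⟩)
          (by simp [ha'])
      have hw₁ : w₁.filter (fun b => decide (b ∉ s₁)) = w₁ := by
        rw [List.filter_eq_self]; intro a ha
        simp only [decide_eq_true_eq]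
        intro ha'
        have hax : a ≠ x := by rintro rfl; exact hs₁ ha'
        simp only [List.filter_append, List.filter_cons, bne_self_eq_false, hsx, he] at hn
        exact List.disjoint_of_nodup_append hn (a := a) (by simp [ha'])
          (by simp [ha, hax])
      have hx : decide (x ∉ s₁) = true := by simpa using hs₁
      rw [List.filter_append, List.filter_append, List.filter_cons, hsf, hr₁, hw₁, if_pos hx,
        List.append_assoc, List.singleton_append, List.isChain_split]
      rw [List.append_assoc, List.cons_append, List.isChain_split] at hw
      refine ⟨hw.1, ?_⟩
      rw [List.isChain_cons] at hw ⊢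
      refine ⟨fun y hy => Or.inr ?_, hw.2.2.right_of_append⟩
      rintro rfl; exact hd hy
    · refine ⟨r₁.filter (fun b => decide (b ∉ s₁)), u'.filter (fun b => decide (b ∉ s₁)), ?_⟩
      have hsf : s₁.filter (fun b => decide (b ∉ s₁)) = [] := by
        rw [List.filter_eq_nil_iff]; intro a ha; simpa using ha
      have hx : decide (x ∉ s₁) = true := by simpa using hs₁
      rw [List.filter_append, List.filter_append, List.filter_cons, List.filter_cons, hsf,
        if_pos hx, if_pos hx]
      simp
  · have hr0 : r.count x = 0 := List.count_eq_zero.2 hxr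
    rw [List.count_append, hr0] at hxu hxw
    simp only [List.count_cons_self, zero_add] at hxu hxw
    obtain ⟨s₂, u'', rfl, hs₂⟩ := List.eq_append_cons_of_mem
      (List.count_pos_iff.1 (show 0 < u'.count x by omega))
    obtain ⟨s₄, w₂, rfl, hs₄⟩ := List.eq_append_cons_of_mem
      (List.count_pos_iff.1 (show 0 < w₁.count x by omega))
    rw [List.count_append, List.count_eq_zero.2 hs₄] at hxw
    simp only [List.count_cons_self, zero_add] at hxw
    obtain ⟨s₅, w'', rfl, hs₅⟩ := List.eq_append_cons_of_mem
      (List.count_pos_iff.1 (show 0 < w₂.count x by omega))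
    have hf : ∀ {s : List α}, x ∉ s → s.filter (· != x) = s := by
      intro s hs
      rw [List.filter_eq_self]; intro a ha; simp; rintro rfl; exact hs ha
    have hs₄0 : s₄ ≠ [] := by rintro rfl; simp at hd
    have hs₅0 : s₅ ≠ [] := by
      rintro rfl
      rw [← List.append_assoc, List.nil_append, List.isChain_append_cons_cons] at hw
      simpa using hw.2.1
    have hs₂0 : s₂ ≠ [] := by
      rintro rfl
      rw [List.nil_append, List.isChain_append_cons_cons] at hu
      simpa using hu.2.1
    simp only [List.filter_append, List.filter_cons, bne_self_eq_false, hf hs₂, hf hs₄, hf hs₅,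
      hf hxr] at hn he
    simp only [Bool.false_eq_true, if_false] at hn he
    have hcut : ∀ {s : List α}, s.filter (fun b => decide (b ∉ s)) = [] := by
      intro s; rw [List.filter_eq_nil_iff]; intro a ha; simpa using ha
    have hkeep : ∀ {s l : List α}, (∀ a ∈ l, a ∉ s) →
        l.filter (fun b => decide (b ∉ s)) = l := by
      intro s l hl
      rw [List.filter_eq_self]; intro a ha; simpa using hl a ha
    have hkeep' : ∀ {s l : List α}, x ∉ s → (∀ a ∈ l.filter (· != x), a ∉ s) →
        l.filter (fun b => decide (b ∉ s)) = l := by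
      intro s l hs hl
      apply hkeep
      intro a ha
      by_cases hax : a = x
      · rwa [hax]
      · exact hl a (by simp [ha, hax])
    have hrx : (r ++ [x]).IsChain fun i j => i ≠ x ∨ j ≠ x := by
      rw [List.isChain_split] at hu; exact hu.1
    have hxu'' : (x :: u'').IsChain fun i j => i ≠ x ∨ j ≠ x := by
      rw [List.isChain_split, List.isChain_cons_split] at hu; exact hu.2.2
    have hxw'' : (x :: w'').IsChain fun i j => i ≠ x ∨ j ≠ x := by
      rw [← List.append_assoc, List.isChain_split, List.isChain_cons_split] at hw; exact hw.2.2
    have hn' := hn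
    rw [he] at hn'
    rcases List.append_eq_append_iff.1 ((List.append_assoc _ _ _).trans he.symm) with
      ⟨d, e₁, e₂⟩ | ⟨d, e₁, e₂⟩
    · subst e₁
      refine ⟨fun b => decide (b ∉ s₅), by simpa using hs₅, Or.inl ⟨?_, ?_⟩⟩
      · have h1 : (r ++ x :: (s₄ ++ s₅ ++ d ++ x :: u'')).filter (fun b => decide (b ∉ s₅)) =
            r ++ x :: ((s₄ ++ d) ++ x :: u'') := by
          have e1 : r.filter (fun b => decide (b ∉ s₅)) = r := hkeep (by grind)
          have e2 : s₄.filter (fun b => decide (b ∉ s₅)) = s₄ := hkeep (by grind)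
          have e3 : d.filter (fun b => decide (b ∉ s₅)) = d := hkeep (by grind)
          have e4 : u''.filter (fun b => decide (b ∉ s₅)) = u'' := hkeep' hs₅ (by grind)
          have hx : decide (x ∉ s₅) = true := by simpa using hs₅
          simp only [List.filter_append, List.filter_cons, hx, e1, e2, e3, e4, hcut, if_true]
          simp
        rw [h1]
        exact isChain_insert (by grind) (by simp [hs₄0]) hrx hxu''
      · have hx : decide (x ∉ s₅) = true := by simpa using hs₅
        refine ⟨(r ++ s₄).filter (fun b => decide (b ∉ s₅)),
          w''.filter (fun b => decide (b ∉ s₅)), ?_⟩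
        simp only [List.filter_append, List.filter_cons, hx, hcut, if_true]
        simp
    · by_cases hd0 : d = []
      · subst hd0
        simp only [List.append_nil] at e₁
        subst e₁
        refine ⟨fun b => decide (b ∉ s₅), by simpa using hs₅, Or.inl ⟨?_, ?_⟩⟩
        · have h1 : (r ++ x :: (s₄ ++ s₅ ++ x :: u'')).filter (fun b => decide (b ∉ s₅)) =
              r ++ x :: (s₄ ++ x :: u'') := by
            have e1 : r.filter (fun b => decide (b ∉ s₅)) = r := hkeep (by grind)
            have e2 : s₄.filter (fun b => decide (b ∉ s₅)) = s₄ := hkeep (by grind)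
            have e4 : u''.filter (fun b => decide (b ∉ s₅)) = u'' := hkeep' hs₅ (by grind)
            have hx : decide (x ∉ s₅) = true := by simpa using hs₅
            simp only [List.filter_append, List.filter_cons, hx, e1, e2, e4, hcut, if_true]
            simp
          rw [h1]
          exact isChain_insert (by grind) (by simp [hs₄0]) hrx hxu''
        · have hx : decide (x ∉ s₅) = true := by simpa using hs₅
          refine ⟨(r ++ s₄).filter (fun b => decide (b ∉ s₅)),
            w''.filter (fun b => decide (b ∉ s₅)), ?_⟩
          simp only [List.filter_append, List.filter_cons, hx, hcut, if_true]
          simp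
      · have hx : decide (x ∉ s₂) = true := by simpa using hs₂
        refine ⟨fun b => decide (b ∉ s₂), by simpa using hs₂, Or.inr ⟨?_, ?_⟩⟩
        · have h1 : (r ++ (s₄ ++ x :: (s₅ ++ x :: w''))).filter (fun b => decide (b ∉ s₂)) =
              (r ++ s₄.filter (fun b => decide (b ∉ s₂))) ++
                x :: (s₅.filter (fun b => decide (b ∉ s₂)) ++ x :: w'') := by
            have e1 : r.filter (fun b => decide (b ∉ s₂)) = r := hkeep (by grind)
            have e4 : w''.filter (fun b => decide (b ∉ s₂)) = w'' := hkeep' hs₂ (by grind)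
            simp only [List.filter_append, List.filter_cons, hx, e1, e4, if_true]
            simp
          rw [h1]
          refine isChain_insert (by grind) ?_ ?_ hxw''
          · have hl : s₅.getLast hs₅0 = d.getLast hd0 := by
              have := congrArg List.getLast? e₁
              rw [List.getLast?_append_of_ne_nil _ hs₅0, List.getLast?_append_of_ne_nil _ hd0,
                List.getLast?_eq_some_getLast hs₅0, List.getLast?_eq_some_getLast hd0] at this
              simpa using this
            apply List.ne_nil_of_mem (a := s₅.getLast hs₅0)
            rw [List.mem_filter]
            refine ⟨List.getLast_mem _, ?_⟩
            simp only [decide_eq_true_eq]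
            have hdm := List.getLast_mem hd0
            rw [hl]
            rw [e₂] at hn
            grind
          · exact isChain_append_singleton_of_notMem (by grind)
        · refine ⟨r.filter (fun b => decide (b ∉ s₂)),
            u''.filter (fun b => decide (b ∉ s₂)), ?_⟩
          simp only [List.filter_append, List.filter_cons, hx, hcut, if_true]
          simp

/-- This turns a proper identity between words in `x` and simple letters into one that has a square
of `x` on one side only. As the words agree without `x`, one of them continues with `x` at the first
difference. -/
theorem exists_filter_separating [DecidableEq α] {x : α} {u w : List α}
    (hn : (u.filter (· != x)).Nodup) (he : u.filter (· != x) = w.filter (· != x))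
    (hu : u.IsChain fun i j => i ≠ x ∨ j ≠ x) (hw : w.IsChain fun i j => i ≠ x ∨ j ≠ x)
    (hxu : 2 ≤ u.count x) (hxw : 2 ≤ w.count x) (hne : u ≠ w) :
    ∃ P : α → Bool, P x ∧
      (((u.filter P).IsChain (fun i j => i ≠ x ∨ j ≠ x) ∧
          ∃ l₁ l₂, w.filter P = l₁ ++ x :: x :: l₂) ∨
        ((w.filter P).IsChain (fun i j => i ≠ x ∨ j ≠ x) ∧
          ∃ l₁ l₂, u.filter P = l₁ ++ x :: x :: l₂)) := by
  obtain ⟨r, u₁, w₁, rfl, rfl, hd⟩ := exists_head?_ne_of_ne hne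
  have he' := he
  simp only [List.filter_append, List.append_cancel_left_eq] at he'
  by_cases h₁ : u₁.head? = some x
  · cases u₁ with
    | nil => simp at h₁
    | cons b u' =>
      simp at h₁
      subst h₁
      exact exists_filter_separating_aux hn (by simpa using he') hu hw
        (fun h => hd (by simp [h])) hxu hxw
  · by_cases h₂ : w₁.head? = some x
    · cases w₁ with
      | nil => simp at h₂
      | cons b w' =>
        simp at h₂
        subst h₂
        obtain ⟨P, hP, h⟩ := exists_filter_separating_aux (he ▸ hn) (by simpa using he'.symm) hw hu
          h₁ hxw hxu
        exact ⟨P, hP, h.symm⟩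
    · exfalso
      cases u₁ with
      | nil =>
        cases w₁ with
        | nil => simp at hd
        | cons b w' => simp at h₂; simp [h₂] at he'
      | cons a u' =>
        simp at h₁
        cases w₁ with
        | nil => simp [h₁] at he'
        | cons b w' =>
          simp at h₂ hd
          simp [h₁, h₂] at he'
          exact hd he'.1

end ListLemmas

/-! ### Good congruences and the collection of a repeated letter. -/

section Congruences

variable {α : Type*}

/-- Fully invariant congruences on the free monoid of lists over `α`. -/
structure Fic (θ : List α → List α → Prop) : Prop where
  refl : ∀ a, θ a a
  symm : ∀ {a b}, θ a b → θ b a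
  trans : ∀ {a b c}, θ a b → θ b c → θ a c
  append : ∀ {a b c d}, θ a b → θ c d → θ (a ++ c) (b ++ d)
  subst : ∀ {a b}, θ a b → ∀ f : α → List α, θ (a.flatMap f) (b.flatMap f)

/-- Fully invariant congruences that satisfy `x² ≈ x³`, `x²y ≈ yx²` and the identities that permit
to collect two occurrences of a letter in one block and to exchange adjacent letters which occur
together in another block. -/
structure Good (θ : List α → List α → Prop) : Prop extends Fic θ where
  cube : ∀ a, θ (a ++ a) (a ++ (a ++ a))
  central : ∀ a b, θ (a ++ (a ++ b)) (b ++ (a ++ a))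
  collect : ∀ p x r q, r.Nodup → (∀ a ∈ r, a ∈ p ∨ a ∈ q) →
    θ (p ++ x :: (r ++ x :: q)) (p ++ x :: x :: (r ++ q))
  exchange_left : ∀ p x y q r s, r.Nodup → (∀ a ∈ r, a ∈ p ∨ a ∈ q ∨ a ∈ s) →
    θ (p ++ x :: y :: (q ++ x :: (r ++ y :: s))) (p ++ y :: x :: (q ++ x :: (r ++ y :: s)))
  exchange_right : ∀ p x y q r s, r.Nodup → (∀ a ∈ r, a ∈ p ∨ a ∈ q ∨ a ∈ s) →
    θ (s ++ y :: (r ++ x :: (q ++ y :: x :: p))) (s ++ y :: (r ++ x :: (q ++ x :: y :: p)))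

variable {θ : List α → List α → Prop}

namespace Fic

theorem of_eq (F : Fic θ) {a b : List α} (e : a = b) : θ a b := e ▸ F.refl a

theorem context (F : Fic θ) {a b : List α} (H : θ a b) (p q : List α) :
    θ (p ++ (a ++ q)) (p ++ (b ++ q)) :=
  F.append (F.refl p) (F.append H (F.refl q))

theorem filter (F : Fic θ) {a b : List α} (H : θ a b) (P : α → Bool) :
    θ (a.filter P) (b.filter P) := by
  rw [filter_eq_flatMap, filter_eq_flatMap]
  exact F.subst H _

theorem inf {φ : List α → List α → Prop} (F : Fic θ) (G : Fic φ) : Fic fun a b => θ a b ∧ φ a b where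
  refl a := ⟨F.refl a, G.refl a⟩
  symm h := ⟨F.symm h.1, G.symm h.2⟩
  trans h k := ⟨F.trans h.1 k.1, G.trans h.2 k.2⟩
  append h k := ⟨F.append h.1 k.1, G.append h.2 k.2⟩
  subst h f := ⟨F.subst h.1 f, G.subst h.2 f⟩

/-- Commutativity of the corresponding variety. -/
def Comm (θ : List α → List α → Prop) : Prop := ∀ a b : α, θ [a, b] [b, a]

theorem perm (F : Fic θ) (C : Comm θ) {p q : List α} (H : p.Perm q) : θ p q := by
  induction H with
  | nil => exact F.refl _
  | cons a _ ih => exact F.append (F.refl [a]) ih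
  | swap a b l => exact F.append (C b a) (F.refl l)
  | trans _ _ h₁ h₂ => exact F.trans h₁ h₂

theorem comm_of_pair [DecidableEq α] (F : Fic θ) {a b : α} (hab : a ≠ b) (H : θ [a, b] [b, a]) :
    Comm θ := by
  intro c d
  simpa [hab.symm] using F.subst H fun e => if e = a then [c] else [d]

end Fic

theorem Good.inf {φ : List α → List α → Prop} (F : Good θ) (G : Good φ) :
    Good fun a b => θ a b ∧ φ a b where
  toFic := F.toFic.inf G.toFic
  cube a := ⟨F.cube a, G.cube a⟩
  central a b := ⟨F.central a b, G.central a b⟩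
  collect p x r q h k := ⟨F.collect p x r q h k, G.collect p x r q h k⟩
  exchange_left p x y q r s h k := ⟨F.exchange_left p x y q r s h k, G.exchange_left p x y q r s h k⟩
  exchange_right p x y q r s h k :=
    ⟨F.exchange_right p x y q r s h k, G.exchange_right p x y q r s h k⟩

namespace Good

open Fic

theorem pull (G : Good θ) (a p q : List α) : θ (p ++ (a ++ (a ++ q))) (a ++ (a ++ (p ++ q))) := by
  have := G.append (G.symm (G.central a p)) (G.refl q)
  simpa using this

theorem cube_append (G : Good θ) (x : α) (m : List α) : θ (x :: x :: x :: m) (x :: x :: m) := by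
  simpa using G.symm (G.append (G.cube [x]) (G.refl m))

theorem idempotent (G : Good θ) {a : α} (H : θ [a] [a, a]) (c : List α) : θ c (c ++ c) := by
  simpa using G.subst H fun _ => c

/-- Every word equals its square, and squares are central. -/
theorem comm_of_square (G : Good θ) {a : α} (H : θ [a] [a, a]) : Comm θ := by
  intro c d
  have h₁ := G.append (G.idempotent H [c]) (G.refl [d])
  have h₂ := G.central [c] [d]
  have h₃ := G.append (G.refl [d]) (G.symm (G.idempotent H [c]))
  exact G.trans h₁ (G.trans h₂ h₃)

variable [DecidableEq α]

theorem absorb (G : Good θ) (x : α) (m : List α) :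
    θ (x :: x :: m) (x :: x :: m.filter (· != x)) := by
  induction m with
  | nil => exact G.refl _
  | cons c m ih =>
    by_cases hc : c = x
    · subst hc
      simpa using G.trans (G.cube_append c m) ih
    · have h₁ := G.symm (G.pull [x] [c] m)
      have h₂ := G.append (G.refl [c]) ih
      have h₃ := G.pull [x] [c] (m.filter (· != x))
      simpa [hc] using G.trans h₁ (G.trans h₂ h₃)

theorem absorb_context (G : Good θ) (x : α) (p q : List α) :
    θ (p ++ x :: x :: q) (x :: x :: (p ++ q).filter (· != x)) :=
  G.trans (G.pull [x] p q) (G.absorb x _)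

/-- The word `p` is equivalent to the word that is obtained by moving the square of `x` to its
beginning and deleting all other occurrences of `x`. -/
def Sq (θ : List α → List α → Prop) (p : List α) (x : α) : Prop :=
  θ p (x :: x :: p.filter (· != x))

theorem sq_of_equiv (G : Good θ) {x : α} {p l₁ l₂ : List α} (H : θ p (l₁ ++ x :: x :: l₂))
    (e : (l₁ ++ l₂).filter (· != x) = p.filter (· != x)) : Sq θ p x := by
  have := G.trans H (G.absorb_context x l₁ l₂)
  rwa [e] at this

/-- Induction on the length of the gap `r`. A further `x` in `r` gives a shorter gap. If `r` has no
repetition, its letters all occur outside of it and the collection law applies. Otherwise some `a`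
is repeated inside `r`: its gap is shorter, so `a` can be collected; after deletion of `a` the gap
of `x` is shorter, so `x` can be collected there. -/
theorem sq_of_block_aux (G : Good θ) (n : ℕ) : ∀ (p p₁ r p₂ : List α) (x : α), r.length = n →
    p = p₁ ++ x :: (r ++ x :: p₂) → (∀ a ∈ r, 2 ≤ p.count a) → Sq θ p x := by
  induction n using Nat.strong_induction_on with
  | _ n ih =>
    rintro p p₁ r p₂ x rfl e hr
    by_cases hx : x ∈ r
    · obtain ⟨r₁, r₂, rfl⟩ := List.append_of_mem hx
      exact ih r₁.length (by simp) p p₁ r₁ (r₂ ++ x :: p₂) x rfl (by simp [e])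
        fun a ha => hr a (by simp [ha])
    by_cases hn : r.Nodup
    · subst e
      have := G.collect p₁ x r p₂ hn fun a ha => by
        have h₁ := hr a ha
        have h₂ := List.nodup_iff_count_le_one.1 hn a
        have hxa : x ≠ a := by rintro rfl; exact hx ha
        simp [hxa] at h₁
        by_contra! h
        rw [List.count_eq_zero.2 h.1, List.count_eq_zero.2 h.2] at h₁
        omega
      exact G.sq_of_equiv this (by simp)
    · obtain ⟨r₁, a, r₂, r₃, rfl⟩ := exists_repeat_of_not_nodup hn
      have hax : a ≠ x := by rintro rfl; simp at hx
      have ha : Sq θ p a := ih r₂.length (by simp; omega) p (p₁ ++ x :: r₁) r₂ (r₃ ++ x :: p₂) a rfl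
        (by simp [e]) fun b hb => hr b (by simp [hb])
      have hx' : Sq θ (p.filter (· != a)) x := by
        refine ih _ ?_ _ (p₁.filter (· != a)) ((r₁ ++ a :: (r₂ ++ a :: r₃)).filter (· != a))
          (p₂.filter (· != a)) x rfl ?_ ?_
        · simp
          have h₁ := List.length_filter_le (· != a) r₁
          have h₂ := List.length_filter_le (· != a) r₂
          have h₃ := List.length_filter_le (· != a) r₃
          omega
        · simp [e, hax.symm]
        · intro b hb
          rw [List.mem_filter] at hb
          rw [List.count_filter (p := (· != a)) hb.2]
          exact hr b hb.1
      -- With p_a for p without a, the chain is p ≈ a²p_a ≈ a²x²p_{a,x} ≈ x²a²p_{a,x} ≈ x²p_x; its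
      -- last step is `ha` with `x` deleted.
      have h₁ := G.filter ha (· != x)
      have h₂ := G.append (G.refl [a, a]) hx'
      have h₃ := G.pull [x] [a, a] ((p.filter (· != a)).filter (· != x))
      have h₄ := G.append (G.refl [x, x]) (G.symm h₁)
      have hc : (p.filter (· != a)).filter (· != x) = (p.filter (· != x)).filter (· != a) := by
        simp [List.filter_filter, Bool.and_comm]
      simp [hax, Sq] at ha h₂ h₃ h₄ hc ⊢
      exact G.trans ha (G.trans h₂ (G.trans h₃ (hc ▸ h₄)))

/-- Two occurrences of a letter in the same block give a square. -/
theorem sq_of_block (G : Good θ) {p₁ r p₂ : List α} {x : α}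
    (hr : ∀ a ∈ r, 2 ≤ (p₁ ++ x :: (r ++ x :: p₂)).count a) :
    Sq θ (p₁ ++ x :: (r ++ x :: p₂)) x :=
  G.sq_of_block_aux _ _ p₁ r p₂ x rfl rfl hr

theorem filter_ne_flatMap {f : α → List α} {x : α} (hf : f x = [x]) (u : List α) :
    ((u.filter (· != x)).flatMap f).filter (· != x) = (u.flatMap f).filter (· != x) := by
  induction u with
  | nil => rfl
  | cons c u ih =>
    by_cases hc : c = x
    · subst hc; simp [ih, hf]
    · simp [hc, ih]

/-- As no two x's are adjacent in the restriction, `p` arises from it, within a context, by a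
substitution that fixes `x` and enlarges its neighbours. The equivalence collecting `x` is lifted
along this substitution. -/
theorem sq_of_filter_chain (G : Good θ) {P : α → Bool} {x : α} {p : List α}
    (hn : ((p.filter P).filter (· != x)).Nodup)
    (hc : (p.filter P).IsChain fun i j => i ≠ x ∨ j ≠ x) (H : Sq θ (p.filter P) x) : Sq θ p x := by
  obtain ⟨g, f, k, e, h₁, -, -⟩ := exists_flatMap_filter P (fun a => P a && a != x)
    (fun a ha => by simp at ha; exact ha.1) p
    (by simpa [List.filter_filter, Bool.and_comm] using hn)
    (by
      rw [List.isChain_iff_forall_rel_of_append_cons_cons] at hc ⊢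
      intro a b l₁ l₂ he
      have := hc he
      have ha : P a := (List.mem_filter.1 (show a ∈ p.filter P by rw [he]; simp)).2
      have hb : P b := (List.mem_filter.1 (show b ∈ p.filter P by rw [he]; simp)).2
      simpa [ha, hb] using this)
  have hf : f x = [x] := h₁ x (Or.inr (by simp))
  have h₂ := G.context (G.subst H f) g k
  rw [← List.append_assoc, ← e] at h₂
  refine G.sq_of_equiv (l₁ := g)
    (l₂ := ((p.filter P).filter (· != x)).flatMap f ++ k) (by simpa [hf] using h₂) ?_
  conv_rhs => rw [e]
  rw [List.filter_append, List.filter_append, filter_ne_flatMap hf]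
  simp

/-- Two x's that become adjacent in the restriction are separated in `p` by repeated letters only,
so they lie in one block; without such a pair the substitution argument applies. -/
theorem sq_of_filter (G : Good θ) {P : α → Bool} {x : α} {p : List α}
    (hn : ((p.filter P).filter (· != x)).Nodup) (hm : ∀ a ∈ p, P a = false → 2 ≤ p.count a)
    (H : Sq θ (p.filter P) x) : Sq θ p x := by
  by_cases hc : (p.filter P).IsChain fun i j => i ≠ x ∨ j ≠ x
  · exact G.sq_of_filter_chain hn hc H
  · obtain ⟨l₁, i, j, l₂, e, hij⟩ := exists_adjacent_of_not_isChain hc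
    push Not at hij
    obtain ⟨rfl, rfl⟩ := hij
    obtain ⟨n₁, n₂, n₃, rfl, -, -, hn₂, -, -⟩ := filter_eq_append_pair e
    exact G.sq_of_block fun a ha => hm a (by simp [ha]) (hn₂ a ha)

theorem replicate_two (G : Good θ) (a : α) {j : ℕ} (hj : 2 ≤ j) :
    θ (List.replicate j a) [a, a] := by
  obtain ⟨k, rfl⟩ := Nat.exists_eq_add_of_le' hj
  have := G.absorb a (List.replicate k a)
  simpa [List.replicate_succ] using this

theorem square_of_replicate (G : Good θ) {a : α} {i j : ℕ} (hi : i ≤ 1) (hij : i ≠ j)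
    (H : θ (List.replicate i a) (List.replicate j a)) : θ [a] [a, a] := by
  obtain rfl | rfl : i = 0 ∨ i = 1 := by omega
  · obtain rfl | hj : j = 1 ∨ 2 ≤ j := by omega
    · simpa using G.append H (G.refl [a])
    · have h₁ := G.append (G.trans H (G.replicate_two a hj)) (G.refl [a])
      exact G.trans h₁ (G.symm (by simpa using G.cube [a]))
  · obtain rfl | hj : j = 0 ∨ 2 ≤ j := by omega
    · simpa using G.append (G.symm H) (G.refl [a])
    · exact G.trans H (G.replicate_two a hj)

theorem replicate_of_equiv (G : Good θ) {p q : List α} (H : θ p q) (a : α) :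
    θ (List.replicate (p.count a) a) (List.replicate (q.count a) a) := by
  have := G.filter H (· == a)
  rwa [List.filter_beq, List.filter_beq] at this

/-- Any other combination of multiplicities restricts to a one-letter identity that forces a ≈ a²,
hence commutativity. -/
theorem count_eq_or (G : Good θ) (hC : ¬ Comm θ) {p q : List α} (H : θ p q) (a : α) :
    p.count a = q.count a ∨ (2 ≤ p.count a ∧ 2 ≤ q.count a) := by
  by_contra! h
  apply hC
  have hr := G.replicate_of_equiv H a
  by_cases h₁ : p.count a ≤ 1
  · exact G.comm_of_square (G.square_of_replicate h₁ h.1 hr)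
  · exact G.comm_of_square (G.square_of_replicate (by have := h.2; omega) h.1.symm (G.symm hr))

/-- By the multiplicities the words are permutations of each other. The letters a, b at the first
difference occur in opposite orders, so restriction to them gives ab ≈ ba. -/
theorem eq_of_nodup (G : Good θ) (hC : ¬ Comm θ) {s s' : List α} (hs : s.Nodup) (H : θ s s') :
    s = s' := by
  by_contra hne
  have hcount : ∀ a, s.count a = s'.count a := fun a => by
    have h₁ := G.count_eq_or hC H a
    have h₂ := List.nodup_iff_count_le_one.1 hs a
    omega
  have hperm : s.Perm s' := List.perm_iff_count.2 hcount
  have hs' := hperm.nodup_iff.1 hs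
  obtain ⟨r, u, w, rfl, rfl, hd⟩ := exists_head?_ne_of_ne hne
  have hp : u.Perm w := (List.perm_append_left_iff r).1 hperm
  cases u with
  | nil => simp [List.nil_perm.1 hp] at hd
  | cons a u =>
    cases w with
    | nil => simp at hp
    | cons b w =>
      have hab : a ≠ b := fun h => hd (by simp [h])
      have hb : b ∈ u := by
        have := hp.mem_iff (a := b)
        simpa [hab.symm] using this
      have ha : a ∈ w := by
        have := hp.mem_iff (a := a)
        simpa [hab] using this
      rw [List.nodup_append] at hs hs'
      obtain ⟨-, hu, hdu⟩ := hs
      obtain ⟨-, hw, hdw⟩ := hs'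
      have hf : ∀ {c d : α} {v : List α}, c ≠ d → (c :: v).Nodup → d ∈ v →
          (c :: v).filter (fun e => e == a || e == b) = [c, d] ∨ ¬ ((c = a ∧ d = b) ∨ (c = b ∧ d = a)) := by
        intro c d v hcd hv hdv
        by_cases hh : (c = a ∧ d = b) ∨ (c = b ∧ d = a)
        · left
          have hcv := (List.nodup_cons.1 hv).1
          have : v.filter (fun e => e == a || e == b) = v.filter (· == d) := by
            apply List.filter_congr
            intro e he
            have : e ≠ c := by rintro rfl; exact hcv he
            grind
          rw [List.filter_cons_of_pos (by grind), this, List.filter_beq,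
            List.count_eq_one_of_mem (List.nodup_cons.1 hv).2 hdv]
          rfl
        · exact Or.inr hh
      have hr : r.filter (fun e => e == a || e == b) = [] := by
        rw [List.filter_eq_nil_iff]
        intro e he
        have h₁ := hdu e he a (by simp)
        have h₂ := hdu e he b (by simp [hb])
        simp [h₁, h₂]
      have h₁ := (hf hab hu hb).resolve_right (by simp)
      have h₂ := (hf hab.symm hw ha).resolve_right (by simp)
      have := G.filter H (fun e => e == a || e == b)
      rw [List.filter_append, List.filter_append, h₁, h₂, hr] at this
      exact hC (G.comm_of_pair hab this)

theorem filter_eq_of_nodup (G : Good θ) (hC : ¬ Comm θ) {p q : List α} (H : θ p q)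
    {P : α → Bool} (hn : (p.filter P).Nodup) : p.filter P = q.filter P :=
  G.eq_of_nodup hC hn (G.filter H P)

theorem sq_of_comm (G : Good θ) (hC : Comm θ) {x : α} {p : List α} (hx : 2 ≤ p.count x) :
    Sq θ p x := by
  obtain ⟨p₁, p₂, rfl⟩ := List.append_of_mem (List.count_pos_iff.1 (show 0 < p.count x by omega))
  have : (p₁ ++ x :: p₂).Perm (x :: (p₁ ++ p₂)) := List.perm_middle
  have hx' : x ∈ p₁ ++ p₂ := by
    rw [this.count_eq] at hx
    simp only [List.count_cons_self] at hx
    exact List.count_pos_iff.1 (by omega)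
  obtain ⟨q₁, q₂, e⟩ := List.append_of_mem hx'
  rw [e] at this
  have h₂ : (p₁ ++ x :: p₂).Perm (x :: x :: (q₁ ++ q₂)) :=
    this.trans (List.Perm.cons x List.perm_middle)
  have h₃ := G.trans (G.perm hC h₂) (G.absorb x _)
  exact G.trans h₃ (G.perm hC (by simpa using (h₂.filter (· != x)).symm))

/-- If a word in which all letters but `x` are simple is not an isoterm, then all occurrences of `x`
can be collected. -/
theorem sq_of_ne (G : Good θ) {x : α} {u w : List α} (hn : (u.filter (· != x)).Nodup)
    (hx : 2 ≤ u.count x) (H : θ u w) (hne : u ≠ w) : Sq θ u x := by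
  by_cases hC : Comm θ
  · exact G.sq_of_comm hC hx
  have he := G.filter_eq_of_nodup hC H hn
  have hxw : 2 ≤ w.count x := by have := G.count_eq_or hC H x; omega
  have hblock : ∀ {v : List α}, ¬ (v.IsChain fun i j => i ≠ x ∨ j ≠ x) → Sq θ v x := by
    intro v hv
    obtain ⟨l₁, i, j, l₂, rfl, hij⟩ := exists_adjacent_of_not_isChain hv
    push Not at hij
    obtain ⟨rfl, rfl⟩ := hij
    exact G.sq_of_equiv (G.refl _) (by simp)
  have hback : Sq θ w x → Sq θ u x := fun h => by
    unfold Sq at h ⊢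
    rw [he]
    exact G.trans H h
  by_cases hu : u.IsChain fun i j => i ≠ x ∨ j ≠ x
  swap
  · exact hblock hu
  by_cases hw : w.IsChain fun i j => i ≠ x ∨ j ≠ x
  swap
  · exact hback (hblock hw)
  -- After restriction one side has a square of `x`, so `x` can be collected in both restricted
  -- words; the side without adjacent x's lifts this to its full word.
  obtain ⟨P, -, ⟨hc, l₁, l₂, e⟩ | ⟨hc, l₁, l₂, e⟩⟩ := exists_filter_separating hn he hu hw hx hxw hne
  all_goals
    have hcomm : ∀ v : List α, (v.filter P).filter (· != x) = (v.filter (· != x)).filter P := by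
      intro v; simp [List.filter_filter, Bool.and_comm]
  · refine G.sq_of_filter_chain (by rw [hcomm]; exact hn.filter _) hc ?_
    refine G.sq_of_equiv (l₁ := l₁) (l₂ := l₂) (e ▸ G.filter H P) ?_
    rw [hcomm, he, ← hcomm, e]
    simp
  · apply hback
    refine G.sq_of_filter_chain (by rw [hcomm, ← he]; exact hn.filter _) hc ?_
    refine G.sq_of_equiv (l₁ := l₁) (l₂ := l₂) (e ▸ G.filter (G.symm H) P) ?_
    rw [hcomm, ← he, ← hcomm, e]
    simp

end Good

end Congruences

/-! ### Prime pairs, and why they determine a good congruence. -/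

section Reflection

open Fic Good

variable {α : Type*} [DecidableEq α]

/-- An identity `u ≈ v` such that every proper identity with the left side `u` implies it, modulo
the identities of good congruences. -/
def Prime (u v : List α) : Prop :=
  ∀ θ : List α → List α → Prop, Good θ → ∀ w, θ u w → u ≠ w → θ u v

theorem count_filter_ne_self (p : List α) (a : α) : (p.filter (· != a)).count a = 0 :=
  List.count_eq_zero.2 (by simp)

theorem prime_replicate (a : α) {i : ℕ} (hi : i ≤ 1) : Prime (List.replicate i a) [a, a] := by
  intro θ G w H hne
  have key : ∀ j, i ≠ j → θ (List.replicate i a) (List.replicate j a) →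
      θ (List.replicate i a) [a, a] := by
    intro j hij h
    have hs := G.square_of_replicate hi hij h
    obtain rfl | rfl : i = 0 ∨ i = 1 := by omega
    · obtain rfl | hj : j = 1 ∨ 2 ≤ j := by omega
      · exact G.trans h hs
      · exact G.trans h (G.replicate_two a hj)
    · exact hs
  by_cases hw : ∃ j, w = List.replicate j a
  · obtain ⟨j, rfl⟩ := hw
    exact key j (fun h => hne (by rw [h])) H
  · obtain ⟨b, hb, hba⟩ : ∃ b ∈ w, b ≠ a := by
      by_contra! h
      exact hw ⟨_, List.eq_replicate_of_mem h⟩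
    have h₁ := G.replicate_of_equiv H b
    -- A foreign letter `b` in `w` equates the empty word with a positive power of `b`; with `a`
    -- substituted for `b`, powers of `a` collapse to the empty word.
    rw [List.count_eq_zero.2 (fun h => hba (List.eq_of_mem_replicate h))] at h₁
    have h₂ := G.subst h₁ fun _ => [a]
    have hk : ∀ n (c : α), (List.replicate n c).flatMap (fun _ => [a]) = List.replicate n a := by
      intro n c; induction n with
      | zero => rfl
      | succ n ih => simp [List.replicate_succ, ih]
    rw [hk, hk] at h₂
    have hpos : 0 < w.count b := List.count_pos_iff.2 hb
    have h₃ : θ [] [a] := by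
      have hs := G.square_of_replicate (by omega) (by omega) h₂
      obtain h | h : w.count b = 1 ∨ 2 ≤ w.count b := by omega
      · rw [h] at h₂; exact h₂
      · exact G.trans (G.trans h₂ (G.replicate_two a h)) (G.symm hs)
    have h₄ : θ [] [a, a] := G.append h₃ h₃
    obtain rfl | rfl : i = 0 ∨ i = 1 := by omega
    · exact h₄
    · exact G.trans (G.symm h₃) h₄

theorem prime_comm {a b : α} (hab : a ≠ b) : Prime [a, b] [b, a] := by
  intro θ G w H hne
  by_contra hC
  exact hne (G.eq_of_nodup (fun h => hC (h a b)) (by simpa using hab) H)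

theorem prime_sq {x : α} {u : List α} (hn : (u.filter (· != x)).Nodup) (hx : 2 ≤ u.count x) :
    Prime u (x :: x :: u.filter (· != x)) :=
  fun _ G _ H hne => G.sq_of_ne hn hx H hne

theorem Good.equiv_of_sq {θ : List α → List α → Prop} (G : Good θ) {p q : List α} {x : α}
    (hp : Sq θ p x) (hq : Sq θ q x) (H : θ (p.filter (· != x)) (q.filter (· != x))) : θ p q :=
  G.trans hp (G.trans (G.append (G.refl [x, x]) H) (G.symm hq))

/-- If `w` agrees with the left side after deleting `a` and after deleting `c`, then `w` is the
swapped word itself. Otherwise one of these deletions leaves a proper identity in one repeated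
letter, which is thus collectable. It can then be collected in both sides of the pair, and they
coincide without it. -/
theorem prime_swap {a c : α} (hac : a ≠ c) {m₁ m₂ : List α}
    (h₁ : (m₁ ++ [c]).IsChain fun i j => (i ≠ a ∧ i ≠ c) ∨ (j ≠ a ∧ j ≠ c))
    (h₂ : (a :: m₂).IsChain fun i j => (i ≠ a ∧ i ≠ c) ∨ (j ≠ a ∧ j ≠ c))
    (hn : ((m₁ ++ c :: a :: m₂).filter fun b => b != a && b != c).Nodup)
    (ha : 2 ≤ (m₁ ++ c :: a :: m₂).count a) (hc : 2 ≤ (m₁ ++ c :: a :: m₂).count c) :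
    Prime (m₁ ++ c :: a :: m₂) (m₁ ++ a :: c :: m₂) := by
  intro θ G w H hne
  by_cases hC : Comm θ
  · exact G.append (G.refl m₁) (G.append (hC c a) (G.refl m₂))
  have hperm : (m₁ ++ a :: c :: m₂).Perm (m₁ ++ c :: a :: m₂) :=
    List.Perm.append_left _ (List.Perm.swap _ _ _)
  have key : ∀ {a' c' : α}, ((a' = a ∧ c' = c) ∨ (a' = c ∧ c' = a)) →
      (m₁ ++ c :: a :: m₂).filter (· != c') ≠ w.filter (· != c') →
      θ (m₁ ++ c :: a :: m₂) (m₁ ++ a :: c :: m₂) := by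
    intro a' c' hcase hne'
    have hac' : a' ≠ c' := by grind
    have haa : 2 ≤ (m₁ ++ c :: a :: m₂).count a' := by grind
    have hcc : 2 ≤ (m₁ ++ c :: a :: m₂).count c' := by grind
    have hn' : (((m₁ ++ c :: a :: m₂).filter (· != c')).filter (· != a')).Nodup := by
      rw [List.filter_filter]
      rcases hcase with ⟨rfl, rfl⟩ | ⟨rfl, rfl⟩
      · exact hn
      · simpa [Bool.and_comm] using hn
    have hsq := G.sq_of_ne hn' (by rwa [List.count_filter (p := (· != c')) (by simpa using hac')])
      (G.filter H (· != c')) hne'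
    have hu : Sq θ (m₁ ++ c :: a :: m₂) a' := by
      refine G.sq_of_filter (P := (· != c')) hn' ?_ hsq
      intro b _ hb
      have : b = c' := by simpa using hb
      rwa [this]
    have hfc : (m₁ ++ a :: c :: m₂).filter (· != c') = (m₁ ++ c :: a :: m₂).filter (· != c') := by
      rcases hcase with ⟨rfl, rfl⟩ | ⟨rfl, rfl⟩ <;>
        grind
    have hfa : (m₁ ++ a :: c :: m₂).filter (· != a') = (m₁ ++ c :: a :: m₂).filter (· != a') := by
      rcases hcase with ⟨rfl, rfl⟩ | ⟨rfl, rfl⟩ <;>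
        grind
    have hv : Sq θ (m₁ ++ a :: c :: m₂) a' := by
      refine G.sq_of_filter (P := (· != c')) (by rw [hfc]; exact hn') ?_ (by rw [hfc]; exact hsq)
      intro b _ hb
      have : b = c' := by simpa using hb
      rw [this, hperm.count_eq]
      exact hcc
    exact G.equiv_of_sq hu hv (G.of_eq hfa.symm)
  by_cases hwc : (m₁ ++ c :: a :: m₂).filter (· != c) = w.filter (· != c)
  swap
  · exact key (Or.inl ⟨rfl, rfl⟩) hwc
  by_cases hwa : (m₁ ++ c :: a :: m₂).filter (· != a) = w.filter (· != a)
  swap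
  · exact key (Or.inr ⟨rfl, rfl⟩) hwa
  rw [← eq_swap_of_filter_eq hac h₁ h₂ hwa hwc hne]
  exact H

/-- In commutative varieties an identity is equivalent to its consequences in one letter. -/
theorem Good.equiv_of_comm {θ : List α → List α → Prop} (G : Good θ) (hC : Comm θ)
    (n : ℕ) : ∀ p q : List α, p.length + q.length = n →
    (∀ a, θ (List.replicate (p.count a) a) (List.replicate (q.count a) a)) → θ p q := by
  induction n using Nat.strong_induction_on with
  | _ n ih =>
    rintro p q rfl H
    by_cases h : ∃ a, a ∈ p ∨ a ∈ q
    · obtain ⟨a, ha⟩ := h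
      have hp : ∀ p : List α, p.Perm (List.replicate (p.count a) a ++ p.filter (· != a)) := by
        intro p
        rw [List.perm_iff_count]
        intro b
        by_cases hb : b = a
        · subst hb
          rw [List.count_append, List.count_replicate_self, count_filter_ne_self]
          rfl
        · rw [List.count_append, List.count_filter (p := (· != a)) (by simpa using hb),
            List.count_replicate]
          simp [Ne.symm hb]
      have hlen : ∀ p : List α, p.length = p.count a + (p.filter (· != a)).length := by
        intro p
        simpa using (hp p).length_eq
      refine G.trans (G.perm hC (hp p)) (G.trans (G.append (H a) ?_) (G.symm (G.perm hC (hp q))))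
      refine ih _ ?_ _ _ rfl ?_
      · have h₁ : 0 < p.count a ∨ 0 < q.count a :=
          ha.imp List.count_pos_iff.2 List.count_pos_iff.2
        have h₂ := hlen p
        have h₃ := hlen q
        omega
      · intro b
        by_cases hb : b = a
        · subst hb
          rw [count_filter_ne_self, count_filter_ne_self]
          exact G.refl _
        · rw [List.count_filter (p := (· != a)) (by simpa using hb),
            List.count_filter (p := (· != a)) (by simpa using hb)]
          exact H b
    · push Not at h
      rw [List.eq_nil_iff_forall_not_mem.2 fun a => (h a).1,
        List.eq_nil_iff_forall_not_mem.2 fun a => (h a).2]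
      exact G.refl _

variable {φ ψ : List α → List α → Prop}

-- The way prime pairs are used: any proper φ-identity with left side `u` produces the prime one in
-- φ, which passes to ψ.
omit [DecidableEq α] in
theorem transfer (Gφ : Good φ) (hP : ∀ u v, Prime u v → φ u v → ψ u v) {u v w : List α}
    (hv : Prime u v) (H : φ u w) (hne : u ≠ w) : ψ u v :=
  hP u v hv (hv φ Gφ w H hne)

theorem le_of_prime_of_comm [Nontrivial α] (Gφ : Good φ) (Gψ : Good ψ)
    (hP : ∀ u v, Prime u v → φ u v → ψ u v) (hC : Comm φ) {p q : List α} (H : φ p q) : ψ p q := by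
  have hCψ : Comm ψ := by
    obtain ⟨a, b, hab⟩ := exists_pair_ne α
    exact Gψ.comm_of_pair hab (hP _ _ (prime_comm hab) (hC a b))
  refine Gψ.equiv_of_comm hCψ _ p q rfl fun a => ?_
  -- An identity between different powers of `a` makes both of them equal to the square of `a` in ψ.
  have key : ∀ {i j : ℕ}, i ≠ j → φ (List.replicate i a) (List.replicate j a) →
      ψ (List.replicate i a) [a, a] := by
    intro i j hij h
    by_cases hi : i ≤ 1
    · refine transfer Gφ hP (prime_replicate a hi) h fun e => hij ?_
      simpa using congrArg List.length e
    · exact Gψ.replicate_two a (by omega)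
  by_cases hij : p.count a = q.count a
  · rw [hij]; exact Gψ.refl _
  · have h := Gφ.replicate_of_equiv H a
    exact Gψ.trans (key hij h) (Gψ.symm (key (Ne.symm hij) (Gφ.symm h)))

/-- The restriction of a word to the letter `x` and the letters in `S`. -/
abbrev restrict (S : α → Bool) (x : α) (p : List α) : List α := p.filter fun b => b == x || S b

theorem restrict_filter_ne {S : α → Bool} {x : α} (hx : S x = false) (p : List α) :
    (restrict S x p).filter (· != x) = p.filter S := by
  rw [List.filter_filter]
  apply List.filter_congr
  intro b _
  by_cases hb : b = x
  · subst hb; simp [hx]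
  · grind

/-- The letters in `S` are exactly the simple letters of `p`. -/
def SimpleLetters (S : α → Bool) (p : List α) : Prop := ∀ b, S b ↔ p.count b = 1

theorem SimpleLetters.nodup {S : α → Bool} {p : List α} (hS : SimpleLetters S p) :
    (p.filter S).Nodup := by
  rw [List.nodup_iff_count_le_one]
  intro b
  by_cases hb : S b
  · rw [List.count_filter hb, (hS b).1 hb]
  · have : b ∉ p.filter S := by simp [hb]
    rw [List.count_eq_zero.2 this]; omega

theorem SimpleLetters.two_le {S : α → Bool} {p : List α} (hS : SimpleLetters S p) {b : α}
    (hb : b ∈ p) (hSb : S b = false) : 2 ≤ p.count b := by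
  have h₁ : 0 < p.count b := List.count_pos_iff.2 hb
  have h₂ : p.count b ≠ 1 := fun h => by simp [(hS b).2 h] at hSb
  omega

theorem SimpleLetters.not_of_two_le {S : α → Bool} {p : List α} (hS : SimpleLetters S p) {b : α}
    (hb : 2 ≤ p.count b) : S b = false := by
  by_contra h
  have := (hS b).1 (by simpa using h)
  omega

theorem SimpleLetters.of_equiv {S : α → Bool} {p q : List α} (Gφ : Good φ) (hC : ¬ Comm φ)
    (H : φ p q) (hS : SimpleLetters S p) : SimpleLetters S q := by
  intro b
  rw [hS b]
  have := Gφ.count_eq_or hC H b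
  omega

/-- Repeated letters do not obstruct collection, so only the position of `x` among the simple
letters matters. -/
theorem sq_iff_restrict (Gψ : Good ψ) {S : α → Bool} {p : List α} (hS : SimpleLetters S p) {x : α}
    (hx : S x = false) : Sq ψ p x ↔ Sq ψ (restrict S x p) x := by
  constructor
  · intro h
    have := Gψ.filter h fun b => b == x || S b
    unfold Sq
    rw [restrict_filter_ne hx]
    have e : (p.filter (· != x)).filter (fun b => b == x || S b) = p.filter S := by
      rw [List.filter_filter]
      apply List.filter_congr
      intro b _
      by_cases hb : b = x
      · subst hb; simp [hx]
      · grind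
    simpa [e] using this
  · intro h
    refine Gψ.sq_of_filter (P := fun b => b == x || S b)
      (by rw [restrict_filter_ne hx]; exact hS.nodup) ?_ h
    intro b hb hSb
    simp at hSb
    exact hS.two_le hb hSb.2

theorem sq_of_restrict_ne (Gφ : Good φ) (Gψ : Good ψ) (hP : ∀ u v, Prime u v → φ u v → ψ u v)
    {S : α → Bool} {p q : List α} (H : φ p q) (hS : SimpleLetters S p)
    {x : α} (hx : S x = false) (hxp : 2 ≤ p.count x) (hne : restrict S x p ≠ restrict S x q) :
    Sq ψ p x := by
  rw [sq_iff_restrict Gψ hS hx]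
  refine transfer Gφ hP (prime_sq ?_ ?_) (Gφ.filter H _) hne
  · rw [restrict_filter_ne hx]; exact hS.nodup
  · rwa [List.count_filter (by simp)]

/-- Collectability modulo ψ is transported along φ. If both words have the same restriction to `x`
and the simple letters, it is the same condition for both; if not, the prime pair of the restriction
of `q` passes from φ to ψ. -/
theorem sq_of_equiv_of_sq (Gφ : Good φ) (Gψ : Good ψ) (hP : ∀ u v, Prime u v → φ u v → ψ u v)
    (hC : ¬ Comm φ) {p q : List α} (H : φ p q) {x : α} (hxp : 2 ≤ p.count x)
    (h : Sq ψ p x) : Sq ψ q x := by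
  let S : α → Bool := fun b => p.count b == 1
  have hS : SimpleLetters S p := fun b => by simp [S]
  have hS' := hS.of_equiv Gφ hC H
  have hx := hS.not_of_two_le hxp
  have hxq : 2 ≤ q.count x := by have := Gφ.count_eq_or hC H x; omega
  by_cases hne : restrict S x p = restrict S x q
  · rw [sq_iff_restrict Gψ hS' hx, ← hne, ← sq_iff_restrict Gψ hS hx]
    exact h
  · exact sq_of_restrict_ne Gφ Gψ hP (Gφ.symm H) hS' hx hxq (Ne.symm hne)

theorem restrict_eq_of_not_sq (Gφ : Good φ) (Gψ : Good ψ)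
    (hP : ∀ u v, Prime u v → φ u v → ψ u v) (hC : ¬ Comm φ) {S : α → Bool} {p q : List α}
    (H : φ p q) (hS : SimpleLetters S p) (hsq : ∀ x, 2 ≤ p.count x → ¬ Sq ψ p x) {x : α}
    (hx : x ∈ p) : restrict S x p = restrict S x q := by
  by_cases hSx : S x
  · have : ∀ p : List α, restrict S x p = p.filter S := by
      intro p
      apply List.filter_congr
      intro b _
      by_cases hb : b = x
      · subst hb; simp [hSx]
      · simp [hb]
    rw [this, this]
    exact Gφ.filter_eq_of_nodup hC H hS.nodup
  · have hSx' : S x = false := by simpa using hSx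
    by_contra hne
    have := hS.two_le hx hSx'
    exact hsq x this (sq_of_restrict_ne Gφ Gψ hP H hS hSx' this hne)

/-- Adjacent letters of a block which occur together in a later block can be exchanged. -/
theorem swap_of_later (Gψ : Good ψ) {m₁ m₂ : List α} {a c : α} (hac : a ≠ c) {P : α → Bool}
    (hPa : P a) (hPc : P c)
    (hm : ∀ b ∈ m₁ ++ c :: a :: m₂, P b = false → 2 ≤ (m₁ ++ c :: a :: m₂).count b)
    (ha : 2 ≤ (m₁ ++ c :: a :: m₂).count a) (hc : 2 ≤ (m₁ ++ c :: a :: m₂).count c)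
    (hsq : ∀ x, 2 ≤ (m₁ ++ c :: a :: m₂).count x → ¬ Sq ψ (m₁ ++ c :: a :: m₂) x)
    (hch : ¬ (a :: m₂.filter P).IsChain fun i j => (i ≠ a ∧ i ≠ c) ∨ (j ≠ a ∧ j ≠ c)) :
    ψ (m₁ ++ c :: a :: m₂) (m₁ ++ a :: c :: m₂) := by
  have hblock : ∀ p₁ x r p₂, m₁ ++ c :: a :: m₂ = p₁ ++ x :: (r ++ x :: p₂) →
      ¬ ∀ b ∈ r, 2 ≤ (m₁ ++ c :: a :: m₂).count b := by
    intro p₁ x r p₂ e hr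
    refine hsq x ?_ (e ▸ Gψ.sq_of_block (by rw [← e]; exact hr))
    rw [e]
    simp
    omega
  obtain ⟨l₁, i, j, l₂, e, hij⟩ := exists_adjacent_of_not_isChain hch
  rw [← List.filter_cons_of_pos hPa] at e
  obtain ⟨n₁, n₂, n₃, e₂, -, -, hn₂, -, -⟩ := filter_eq_append_pair e
  have hn₂m : ∀ b ∈ n₂, 2 ≤ (m₁ ++ c :: a :: m₂).count b := by
    intro b hb
    refine hm b ?_ (hn₂ b hb)
    rw [e₂]; simp [hb]
  -- Two equal letters separated by repeated letters only could be collected, against `hsq`. The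
  -- same argument excludes repetitions in `n₂`.
  have hne : i ≠ j := by
    rintro rfl
    exact hblock (m₁ ++ c :: n₁) i n₂ n₃ (by rw [e₂]; simp) hn₂m
  cases n₁ with
  -- Here the bad pair begins with the `a` that is to be swapped, so the word contains c a n₂ c with
  -- only repeated letters between the two c's, and `c` could be collected.
  | nil =>
    exfalso
    simp at e₂
    obtain ⟨rfl, e₂⟩ := e₂
    have hj : j = c := by grind
    subst hj
    refine hblock m₁ j (a :: n₂) n₃ (by rw [e₂]; simp) ?_
    intro b hb
    rcases List.mem_cons.1 hb with rfl | hb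
    · exact ha
    · exact hn₂m b hb
  | cons d n₁ =>
    simp at e₂
    obtain ⟨rfl, rfl⟩ := e₂
    have hnd : n₂.Nodup := by
      by_contra h
      obtain ⟨r₁, b, r₂, r₃, rfl⟩ := exists_repeat_of_not_nodup h
      exact hblock (m₁ ++ c :: a :: (n₁ ++ i :: r₁)) b r₂ (r₃ ++ j :: n₃) (by simp)
        fun d hd => hn₂m d (by simp [hd])
    have hmem : ∀ b ∈ n₂, b ∈ m₁ ∨ b ∈ n₁ ∨ b ∈ n₃ := by
      intro b hb
      have h₁ := hn₂m b hb
      have h₂ := List.nodup_iff_count_le_one.1 hnd b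
      have hba : b ≠ a := by rintro rfl; simp [hn₂ b hb] at hPa
      have hbc : b ≠ c := by rintro rfl; simp [hn₂ b hb] at hPc
      by_contra! h
      have hbi : i ≠ b := by grind
      have hbj : j ≠ b := by grind
      simp [hba.symm, hbc.symm, hbi, hbj, List.count_eq_zero.2 h.1, List.count_eq_zero.2 h.2.1,
        List.count_eq_zero.2 h.2.2] at h₁
      omega
    push Not at hij
    have hij' : (i = c ∧ j = a) ∨ (i = a ∧ j = c) := by grind
    rcases hij' with ⟨rfl, rfl⟩ | ⟨rfl, rfl⟩
    · exact Gψ.exchange_left m₁ i j n₁ n₂ n₃ hnd hmem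
    · exact Gψ.symm (Gψ.exchange_left m₁ i j n₁ n₂ n₃ hnd hmem)

/-- Adjacent letters of a block which occur together in an earlier block can be exchanged. -/
theorem swap_of_earlier (Gψ : Good ψ) {m₁ m₂ : List α} {a c : α} (hac : a ≠ c) {P : α → Bool}
    (hPa : P a) (hPc : P c)
    (hm : ∀ b ∈ m₁ ++ c :: a :: m₂, P b = false → 2 ≤ (m₁ ++ c :: a :: m₂).count b)
    (ha : 2 ≤ (m₁ ++ c :: a :: m₂).count a) (hc : 2 ≤ (m₁ ++ c :: a :: m₂).count c)
    (hsq : ∀ x, 2 ≤ (m₁ ++ c :: a :: m₂).count x → ¬ Sq ψ (m₁ ++ c :: a :: m₂) x)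
    (hch : ¬ (m₁.filter P ++ [c]).IsChain fun i j => (i ≠ a ∧ i ≠ c) ∨ (j ≠ a ∧ j ≠ c)) :
    ψ (m₁ ++ c :: a :: m₂) (m₁ ++ a :: c :: m₂) := by
  have hblock : ∀ p₁ x r p₂, m₁ ++ c :: a :: m₂ = p₁ ++ x :: (r ++ x :: p₂) →
      ¬ ∀ b ∈ r, 2 ≤ (m₁ ++ c :: a :: m₂).count b := by
    intro p₁ x r p₂ e hr
    refine hsq x ?_ (e ▸ Gψ.sq_of_block (by rw [← e]; exact hr))
    rw [e]
    simp
    omega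
  obtain ⟨l₁, i, j, l₂, e, hij⟩ := exists_adjacent_of_not_isChain hch
  have hsingle : [c] = [c].filter P := by simp [hPc]
  rw [hsingle, ← List.filter_append] at e
  obtain ⟨n₁, n₂, n₃, e₂, -, -, hn₂, -, -⟩ := filter_eq_append_pair e
  have e₃ : m₁ ++ c :: a :: m₂ = n₁ ++ i :: (n₂ ++ j :: (n₃ ++ a :: m₂)) := by
    have := congrArg (· ++ a :: m₂) e₂
    simpa using this
  have hn₂m : ∀ b ∈ n₂, 2 ≤ (m₁ ++ c :: a :: m₂).count b := by
    intro b hb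
    refine hm b ?_ (hn₂ b hb)
    rw [e₃]; simp [hb]
  have hne : i ≠ j := by
    rintro rfl
    exact hblock _ _ _ _ e₃ hn₂m
  rcases List.eq_nil_or_concat' n₃ with rfl | ⟨n₃, d, rfl⟩
  · exfalso
    have e₄ : m₁ ++ [c] = (n₁ ++ i :: n₂) ++ [j] := by rw [e₂]; simp
    obtain ⟨e₅, e₆⟩ := List.append_inj' e₄ rfl
    simp at e₆
    subst e₆
    have hi : i = a := by grind
    subst hi
    refine hblock n₁ i (n₂ ++ [c]) m₂ (by rw [e₅]; simp) ?_
    intro b hb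
    rcases List.mem_append.1 hb with hb | hb
    · exact hn₂m b hb
    · rw [List.mem_singleton.1 hb]; exact hc
  · have e₄ : m₁ ++ [c] = (n₁ ++ i :: (n₂ ++ j :: n₃)) ++ [d] := by rw [e₂]; simp
    obtain ⟨rfl, e₆⟩ := List.append_inj' e₄ rfl
    have hnd : n₂.Nodup := by
      by_contra h
      obtain ⟨r₁, b, r₂, r₃, rfl⟩ := exists_repeat_of_not_nodup h
      exact hblock (n₁ ++ i :: r₁) b r₂ (r₃ ++ j :: (n₃ ++ c :: a :: m₂)) (by simp)
        fun d hd => hn₂m d (by simp [hd])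
    have hmem : ∀ b ∈ n₂, b ∈ m₂ ∨ b ∈ n₃ ∨ b ∈ n₁ := by
      intro b hb
      have h₁ := hn₂m b hb
      have h₂ := List.nodup_iff_count_le_one.1 hnd b
      have hba : b ≠ a := by rintro rfl; simp [hn₂ b hb] at hPa
      have hbc : b ≠ c := by rintro rfl; simp [hn₂ b hb] at hPc
      by_contra! h
      have hbi : i ≠ b := by grind
      have hbj : j ≠ b := by grind
      simp [hba.symm, hbc.symm, hbi, hbj, List.count_eq_zero.2 h.1, List.count_eq_zero.2 h.2.1,
        List.count_eq_zero.2 h.2.2] at h₁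
      omega
    push Not at hij
    have hij' : (i = c ∧ j = a) ∨ (i = a ∧ j = c) := by grind
    rcases hij' with ⟨rfl, rfl⟩ | ⟨rfl, rfl⟩
    · simpa using Gψ.exchange_right m₂ j i n₃ n₂ n₁ hnd hmem
    · simpa using Gψ.symm (Gψ.exchange_right m₂ j i n₃ n₂ n₁ hnd hmem)

/-- Restrict to a, c and the simple letters. If the restriction has another adjacent pair from {a,
c}, an exchange law, or collection contradicting `hsq`, settles the matter. Otherwise the restricted
swap is prime and passes from φ to ψ; a substitution enlarging simple letters then restores the full
words. -/
theorem swap_of_ne (Gφ : Good φ) (Gψ : Good ψ) (hP : ∀ u v, Prime u v → φ u v → ψ u v)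
    {m₁ m₂ w : List α} {a c : α} (hac : a ≠ c) {S : α → Bool}
    (hS : SimpleLetters S (m₁ ++ c :: a :: m₂))
    (ha : 2 ≤ (m₁ ++ c :: a :: m₂).count a) (hc : 2 ≤ (m₁ ++ c :: a :: m₂).count c)
    (hsq : ∀ x, 2 ≤ (m₁ ++ c :: a :: m₂).count x → ¬ Sq ψ (m₁ ++ c :: a :: m₂) x)
    (H : φ (m₁ ++ c :: a :: m₂) w)
    (hne : (m₁ ++ c :: a :: m₂).filter (fun b => (b == a || b == c) || S b) ≠
      w.filter (fun b => (b == a || b == c) || S b)) :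
    ψ (m₁ ++ c :: a :: m₂) (m₁ ++ a :: c :: m₂) := by
  obtain ⟨P, hPdef⟩ : ∃ P : α → Bool, P = fun b => (b == a || b == c) || S b := ⟨_, rfl⟩
  rw [← hPdef] at hne
  have hPa : P a := by simp [hPdef]
  have hPc : P c := by simp [hPdef]
  have hm : ∀ b ∈ m₁ ++ c :: a :: m₂, P b = false → 2 ≤ (m₁ ++ c :: a :: m₂).count b := by
    intro b hb hPb
    refine hS.two_le hb ?_
    simp [hPdef] at hPb
    exact hPb.2
  by_cases h₂ : (a :: m₂.filter P).IsChain fun i j => (i ≠ a ∧ i ≠ c) ∨ (j ≠ a ∧ j ≠ c)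
  swap
  · exact swap_of_later Gψ hac hPa hPc hm ha hc hsq h₂
  by_cases h₁ : (m₁.filter P ++ [c]).IsChain fun i j => (i ≠ a ∧ i ≠ c) ∨ (j ≠ a ∧ j ≠ c)
  swap
  · exact swap_of_earlier Gψ hac hPa hPc hm ha hc hsq h₁
  have hSa := hS.not_of_two_le ha
  have hSc := hS.not_of_two_le hc
  have hu : (m₁ ++ c :: a :: m₂).filter P = m₁.filter P ++ c :: a :: m₂.filter P := by
    simp [hPa, hPc]
  have hprime : ψ (m₁.filter P ++ c :: a :: m₂.filter P) (m₁.filter P ++ a :: c :: m₂.filter P) := by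
    refine transfer Gφ hP (prime_swap hac h₁ h₂ ?_ ?_ ?_) (hu ▸ Gφ.filter H P) (hu ▸ hne)
    · rw [← hu, List.filter_filter]
      convert hS.nodup using 1
      apply List.filter_congr
      intro b _
      by_cases hba : b = a
      · subst hba; simp [hSa]
      · by_cases hbc : b = c
        · subst hbc; simp [hSc]
        · grind
    · rw [← hu, List.count_filter hPa]; exact ha
    · rw [← hu, List.count_filter hPc]; exact hc
  have hSof : ∀ b, P b → (b ≠ a ∧ b ≠ c) → S b := by
    intro b hb hbb
    simpa [hPdef, hbb.1, hbb.2] using hb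
  have hchain : ∀ l : List α, ((l.filter P).IsChain
      fun i j => (i ≠ a ∧ i ≠ c) ∨ (j ≠ a ∧ j ≠ c)) → (l.filter P).IsChain fun i j => S i ∨ S j := by
    intro l hl
    rw [List.isChain_iff_forall_rel_of_append_cons_cons] at hl ⊢
    intro i j l₁ l₂ e
    have hi : P i := (List.mem_filter.1 (show i ∈ l.filter P by rw [e]; simp)).2
    have hj : P j := (List.mem_filter.1 (show j ∈ l.filter P by rw [e]; simp)).2
    exact (hl e).imp (hSof i hi) (hSof j hj)
  have hSP : ∀ b, S b → P b := fun b hb => by simp [hPdef, hb]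
  have hn := hS.nodup
  simp only [List.filter_append] at hn
  have hdisj : ∀ b, S b → b ∈ m₁ → b ∈ m₂ → False := by
    intro b hb h₁ h₂
    have := (hS b).1 hb
    have h₁ := List.count_pos_iff.2 h₁
    have h₂ := List.count_pos_iff.2 h₂
    simp [List.count_append, List.count_cons] at this
    omega
  -- Both sides of the pair are expanded separately, with leftover letters only at the outer ends,
  -- so that c and a stay adjacent. The substitutions do not interfere: no simple letter occurs on
  -- both sides.
  obtain ⟨f₂, k, e₂, hf₂⟩ := exists_flatMap_filter_left P S hSP m₂
    (by
      have := (List.nodup_append.1 hn).2.1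
      simpa [hSa, hSc] using this)
    (hchain _ h₂.tail) (by
      intro b hb
      rw [List.isChain_cons] at h₂
      have := h₂.1 b hb
      exact hSof b (List.mem_filter.1 (List.mem_of_head? hb)).2 (by simpa using this))
  obtain ⟨g, f₁, e₁, hf₁⟩ := exists_flatMap_filter_right P S hSP m₁ (List.nodup_append.1 hn).1
    (hchain _ h₁.left_of_append) (by
      intro b hb
      rw [List.isChain_append] at h₁
      have := h₁.2.2 b hb c (by simp)
      exact hSof b (List.mem_filter.1 (List.mem_of_getLast? hb)).2 (by simpa using this))
  have hfix₁ : (m₂.filter P).flatMap f₁ = m₂.filter P := by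
    apply flatMap_eq_self
    intro b hb
    apply hf₁
    by_cases hSb : S b
    · exact Or.inl fun h => hdisj b hSb h (List.mem_filter.1 hb).1
    · exact Or.inr (by simpa using hSb)
  have hfix₂ : ((m₁.filter P).flatMap f₁).flatMap f₂ = (m₁.filter P).flatMap f₁ := by
    apply flatMap_eq_self
    intro b hb
    apply hf₂
    by_cases hSb : S b
    · refine Or.inl fun h => hdisj b hSb ?_ h
      rw [e₁]
      exact List.mem_append_right _ hb
    · exact Or.inr (by simpa using hSb)
  have key := Gψ.context (Gψ.subst (Gψ.subst hprime f₁) f₂) g k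
  simp only [List.flatMap_append, List.flatMap_cons, hf₁ a (Or.inr hSa), hf₁ c (Or.inr hSc),
    hf₂ a (Or.inr hSa), hf₂ c (Or.inr hSc), hfix₁, hfix₂, 
    List.cons_append, List.nil_append, List.append_assoc, ← e₂] at key
  rw [← List.append_assoc, ← List.append_assoc g, ← e₁] at key
  exact key

/-- Sorting by adjacent swaps. `r` is the part already matched, and the first occurrence in `q` of
the next letter `a` of `p` is moved left past its neighbours. Each swap holds in ψ, hence by `hle`
in φ, so the hypothesis persists. -/
theorem equiv_of_not_sq (Gφ : Good φ) (Gψ : Good ψ) (hle : ∀ p q, ψ p q → φ p q)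
    (hP : ∀ u v, Prime u v → φ u v → ψ u v) (hC : ¬ Comm φ) (p : List α) : ∀ r q : List α,
    φ (r ++ p) (r ++ q) → (∀ x, 2 ≤ (r ++ p).count x → ¬ Sq ψ (r ++ p) x) →
      ψ (r ++ p) (r ++ q) := by
  induction p with
  | nil =>
    intro r q H hsq
    have hS : SimpleLetters (fun b => (r ++ []).count b == 1) (r ++ []) := fun b => by simp
    have : q = [] := by
      rw [List.eq_nil_iff_forall_not_mem]
      intro b hb
      have hpos := List.count_pos_iff.2 hb
      have h₁ := Gφ.count_eq_or hC H b
      simp only [List.count_append, List.count_nil] at h₁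
      have hbr : b ∈ r ++ [] := by
        apply List.count_pos_iff.1
        simp only [List.count_append, List.count_nil]
        omega
      have h₂ := restrict_eq_of_not_sq Gφ Gψ hP hC H hS hsq hbr
      simp only [restrict, List.filter_append, List.append_cancel_left_eq] at h₂
      have h₃ := (List.filter_eq_nil_iff.1 h₂.symm) b hb
      simp at h₃
    rw [this]
    exact Gψ.refl _
  | cons a p ih =>
    have inner : ∀ (n : ℕ) (r q₁ q₂ : List α), q₁.length = n → a ∉ q₁ →
        φ (r ++ a :: p) (r ++ (q₁ ++ a :: q₂)) →
        (∀ x, 2 ≤ (r ++ a :: p).count x → ¬ Sq ψ (r ++ a :: p) x) →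
        ψ (r ++ a :: p) (r ++ (q₁ ++ a :: q₂)) := by
      intro n
      induction n with
      | zero =>
        intro r q₁ q₂ hl _ H hsq
        rw [List.length_eq_zero_iff] at hl
        subst hl
        have := ih (r ++ [a]) q₂ (by simpa using H) (by simpa using hsq)
        simpa using this
      | succ n ihn =>
        intro r q₁ q₂ hl haq H hsq
        rcases List.eq_nil_or_concat' q₁ with rfl | ⟨q₁, c, rfl⟩
        · simp at hl
        obtain ⟨S, hS⟩ : ∃ S, SimpleLetters S (r ++ a :: p) :=
          ⟨fun b => (r ++ a :: p).count b == 1, fun b => by simp⟩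
        have hS' := hS.of_equiv Gφ hC H
        simp only [List.mem_append, List.mem_singleton, not_or] at haq
        obtain ⟨haq, hac⟩ := haq
        have hq : r ++ ((q₁ ++ [c]) ++ a :: q₂) = (r ++ q₁) ++ c :: a :: q₂ := by simp
        rw [hq] at H hS' ⊢
        -- The letters that `a` has to pass are repeated: a simple one would precede `a` in the
        -- restriction of the right word, whereas that of the left word continues with `a` after
        -- `r`.
        have hSq : ∀ b ∈ q₁ ++ [c], S b = false := by
          have h₂ := restrict_eq_of_not_sq Gφ Gψ hP hC H hS hsq (x := a) (by simp)
          simp only [restrict, List.append_assoc, List.filter_append,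
            List.append_cancel_left_eq] at h₂
          have hq₂ : c :: a :: q₂ = [c] ++ a :: q₂ := rfl
          rw [hq₂, List.filter_append, ← List.append_assoc, ← List.filter_append] at h₂
          cases hf : (q₁ ++ [c]).filter (fun b => b == a || S b) with
          | nil =>
            intro b hb
            have := (List.filter_eq_nil_iff.1 hf) b hb
            simp at this
            exact this.2
          | cons d l =>
            exfalso
            rw [hf] at h₂
            simp at h₂
            have hd : d ∈ (q₁ ++ [c]).filter (fun b => b == a || S b) := by rw [hf]; simp
            rw [← h₂.1] at hd
            have := (List.mem_filter.1 hd).1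
            simp [haq, hac] at this
        have hSc : S c = false := hSq c (by simp)
        have hcq : 2 ≤ ((r ++ q₁) ++ c :: a :: q₂).count c := hS'.two_le (by simp) hSc
        have hcp : 2 ≤ (r ++ a :: p).count c := by have := Gφ.count_eq_or hC H c; omega
        -- `a` is repeated too: otherwise the restrictions to `c` and the simple letters would
        -- continue after `r` with `a` on the left and with another letter on the right.
        have hSa : S a = false := by
          by_contra hSa
          have hSa : S a = true := by simpa using hSa
          have h₂ := restrict_eq_of_not_sq Gφ Gψ hP hC H hS hsq (x := c)
            (List.count_pos_iff.1 (by omega))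
          simp only [restrict, List.append_assoc, List.filter_append,
            List.append_cancel_left_eq] at h₂
          rw [List.filter_cons_of_pos (by simp [hSa]), List.filter_cons_of_pos (a := c) (by simp)] at h₂
          cases hf : q₁.filter (fun b => b == c || S b) with
          | nil =>
            rw [hf] at h₂
            simp at h₂
            exact hac h₂.1
          | cons d l =>
            rw [hf] at h₂
            simp at h₂
            have hd : d ∈ q₁.filter (fun b => b == c || S b) := by rw [hf]; simp
            rw [← h₂.1] at hd
            exact haq (List.mem_filter.1 hd).1
        have haq' : 2 ≤ ((r ++ q₁) ++ c :: a :: q₂).count a := hS'.two_le (by simp) hSa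
        have hsq' : ∀ x, 2 ≤ ((r ++ q₁) ++ c :: a :: q₂).count x →
            ¬ Sq ψ ((r ++ q₁) ++ c :: a :: q₂) x := by
          intro x hx h
          refine hsq x ?_ (sq_of_equiv_of_sq Gφ Gψ hP hC (Gφ.symm H) hx h)
          have := Gφ.count_eq_or hC H x
          omega
        have hswap := swap_of_ne Gφ Gψ hP hac hS' haq' hcq hsq' (Gφ.symm H) (by
          rw [List.append_assoc, List.filter_append, List.filter_append]
          simp only [ne_eq]
          rw [List.filter_append, List.filter_cons_of_pos (a := c) (by simp),
            List.filter_cons_of_pos (a := a) (l := p) (by simp)]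
          intro h₂
          cases hf : q₁.filter (fun b => (b == a || b == c) || S b) with
          | nil =>
            rw [hf] at h₂
            simp at h₂
            exact hac h₂.1.symm
          | cons d l =>
            rw [hf] at h₂
            simp at h₂
            have hd : d ∈ q₁.filter (fun b => (b == a || b == c) || S b) := by rw [hf]; simp
            rw [h₂.1] at hd
            exact haq (List.mem_filter.1 hd).1)
        have hψ := ihn r q₁ (c :: q₂) (by simpa using hl) haq
          (by simpa using Gφ.trans H (hle _ _ hswap)) hsq
        refine Gψ.trans hψ (Gψ.symm ?_)
        simpa using hswap
    intro r q H hsq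
    have haq : a ∈ q := by
      have hS : SimpleLetters (fun b => (r ++ a :: p).count b == 1) (r ++ a :: p) :=
        fun b => by simp
      have h₂ := restrict_eq_of_not_sq Gφ Gψ hP hC H hS hsq (x := a) (by simp)
      simp only [restrict, List.filter_append, List.append_cancel_left_eq] at h₂
      rw [List.filter_cons_of_pos (by simp)] at h₂
      have : a ∈ q.filter (fun b => b == a || (r ++ a :: p).count b == 1) := by
        rw [← h₂]; simp
      exact (List.mem_filter.1 this).1
    obtain ⟨q₁, q₂, rfl, hq₁⟩ := List.eq_append_cons_of_mem haq
    exact inner _ r q₁ q₂ rfl hq₁ H hsq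

/-- A good congruence is determined by its prime pairs. -/
theorem le_of_prime_of_le [Nontrivial α] (Gφ : Good φ) (Gψ : Good ψ) (hle : ∀ p q, ψ p q → φ p q)
    (hP : ∀ u v, Prime u v → φ u v → ψ u v) {p q : List α} (H : φ p q) : ψ p q := by
  by_cases hC : Comm φ
  · exact le_of_prime_of_comm Gφ Gψ hP hC H
  induction hl : p.length using Nat.strong_induction_on generalizing p q with
  | _ n ih =>
    -- A collectable letter can be collected in both words and deleted from both, which shortens
    -- `p`.
    by_cases h : ∃ x, 2 ≤ p.count x ∧ Sq ψ p x
    · obtain ⟨x, hx, hsq⟩ := h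
      refine Gψ.equiv_of_sq hsq (sq_of_equiv_of_sq Gφ Gψ hP hC H hx hsq) ?_
      refine ih _ ?_ (Gφ.filter H _) rfl
      rw [← hl, List.length_filter_lt_length_iff_exists]
      exact ⟨x, List.count_pos_iff.1 (by omega), by simp⟩
    · push Not at h
      exact equiv_of_not_sq Gφ Gψ hle hP hC p [] q H h

/-- Replacing ψ by its intersection with φ supplies the inclusion that the sorting argument needs.
-/
theorem le_of_prime [Nontrivial α] (Gφ : Good φ) (Gψ : Good ψ)
    (hP : ∀ u v, Prime u v → φ u v → ψ u v) {p q : List α} (H : φ p q) : ψ p q :=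
  (le_of_prime_of_le Gφ (Gψ.inf Gφ) (fun _ _ h => h.2) (fun u v h k => ⟨hP u v h k, k⟩) H).1

end Reflection

/-! ### Lists as values of indexed products of letters. -/

section Words

variable {α β : Type*}

theorem exists_perm_of_list_perm {A B : List α} (H : A.Perm B) : ∀ n, A.length = n →
    ∃ σ : Equiv.Perm (Fin n), ∀ i : Fin n, A[(σ i : ℕ)]? = B[(i : ℕ)]? := by
  induction H with
  | nil => exact fun n _ => ⟨1, fun i => rfl⟩
  | @cons a A B _ ih =>
    rintro _ rfl
    obtain ⟨σ, hσ⟩ := ih _ rfl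
    refine ⟨Equiv.Perm.decomposeFin.symm (0, σ), fun i => ?_⟩
    refine Fin.cases ?_ (fun i => ?_) i
    · rw [Equiv.Perm.decomposeFin_symm_apply_zero]
      rfl
    · rw [Equiv.Perm.decomposeFin_symm_apply_succ]
      simpa using hσ i
  | swap a b l =>
    rintro _ rfl
    refine ⟨Equiv.swap 0 1, fun i => ?_⟩
    refine Fin.cases (by simp) (fun i => Fin.cases (by simp) (fun i => ?_) i) i
    rw [Equiv.swap_apply_of_ne_of_ne]
    · simp
    · simp [Fin.ext_iff]
    · simp [Fin.ext_iff]
  | trans h₁ _ ih₁ ih₂ =>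
    rintro n hn
    obtain ⟨σ, hσ⟩ := ih₁ n hn
    obtain ⟨τ, hτ⟩ := ih₂ n (by rw [← h₁.length_eq, hn])
    exact ⟨σ * τ, fun i => (hσ (τ i)).trans (hτ i)⟩

theorem exists_perm_map_some (P : α → Bool) (r : List α) :
    ∃ k, ((r.filter P).map some ++ List.replicate k none).Perm
      (r.map fun a => if P a then some a else none) := by
  induction r with
  | nil => exact ⟨0, by simp⟩
  | cons a r ih =>
    obtain ⟨k, hk⟩ := ih
    by_cases ha : P a
    · exact ⟨k, by simpa [ha] using hk⟩
    · refine ⟨k + 1, ?_⟩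
      simp only [ha, List.replicate_succ, List.map_cons]
      rw [List.filter_cons_of_neg (by simpa using ha)]
      exact List.perm_middle.trans (List.Perm.cons none hk)

/-- `L` is padded with `none` up to the length of `r`, so a single permutation of all positions
lists the letters of `r` in `P` and yields nothing elsewhere. Empty values under substitution then
absorb the unused letters. -/
theorem exists_perm_filter {P : α → Bool} {L r : List α} (H : L.Perm (r.filter P)) :
    ∃ σ : Equiv.Perm (Fin r.length), ∀ i : Fin r.length,
      L[(σ i : ℕ)]? = if P r[i] then some r[i] else none := by
  obtain ⟨k, hk⟩ := exists_perm_map_some P r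
  have h₁ : (L.map some ++ List.replicate k none).Perm
      (r.map fun a => if P a then some a else none) :=
    ((H.map some).append_right _).trans hk
  obtain ⟨σ, hσ⟩ := exists_perm_of_list_perm h₁ r.length (by rw [h₁.length_eq]; simp)
  refine ⟨σ, fun i => ?_⟩
  have h₂ := congrArg Option.join (hσ i)
  have h₃ : ∀ j : ℕ, ((L.map some ++ List.replicate k none)[j]?).join = L[j]? := by
    intro j
    rw [List.getElem?_append]
    split_ifs with hj
    · simp only [List.getElem?_map]
      cases L[j]? <;> rfl
    · rw [List.getElem?_replicate]
      simp at hj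
      simp [hj]
      split_ifs <;> rfl
  rw [h₃] at h₂
  simpa using h₂

/-- This matches `p` with a product of factors z_i t_i: z_i takes the i-th letter of `L`, t_i the
gap after it. Factors beyond the length of `L` are empty, which allows any larger `n`. -/
theorem exists_interleave_right {L p : List α} (H : L.Sublist p) :
    ∃ (p₀ : List α) (g : ℕ → List α), ∀ n, L.length ≤ n →
      p = p₀ ++ (List.ofFn fun i : Fin n => (L[(i : ℕ)]?).toList ++ g i).flatten := by
  induction H with
  | slnil =>
    refine ⟨[], fun _ => [], fun n _ => ?_⟩
    simp
  | cons a _ ih =>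
    obtain ⟨p₀, g, hg⟩ := ih
    exact ⟨a :: p₀, g, fun n hn => by rw [List.cons_append, ← hg n hn]⟩
  | cons_cons a _ ih =>
    obtain ⟨p₀, g, hg⟩ := ih
    refine ⟨[], fun i => Nat.casesOn i p₀ g, fun n hn => ?_⟩
    obtain ⟨n, rfl⟩ : ∃ m, n = m + 1 := ⟨n - 1, by simp at hn; omega⟩
    rw [List.ofFn_succ]
    have := hg n (by simpa using hn)
    conv_lhs => rw [this]
    simp

theorem exists_interleave_left {L p : List α} (H : L.Sublist p) :
    ∃ (p₀ : List α) (g : ℕ → List α), ∀ n, L.length ≤ n →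
      p = (List.ofFn fun i : Fin n => g i ++ (L[(i : ℕ)]?).toList).flatten ++ p₀ := by
  induction H with
  | slnil =>
    refine ⟨[], fun _ => [], fun n _ => ?_⟩
    simp
  | @cons L p a _ ih =>
    obtain ⟨p₀, g, hg⟩ := ih
    cases L with
    | nil =>
      -- With no letter of `L` left to precede, the rest of the word goes into the remainder.
      refine ⟨a :: p, fun _ => [], fun n _ => ?_⟩
      have : (List.ofFn fun i : Fin n =>
          ([] : List α) ++ (([] : List α)[(i : ℕ)]?).toList).flatten = [] := by
        simp
      rw [this]
      rfl
    | cons b L =>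
      refine ⟨p₀, fun i => Nat.casesOn i (a :: g 0) (fun j => g (j + 1)), fun n hn => ?_⟩
      obtain ⟨n, rfl⟩ : ∃ m, n = m + 1 := ⟨n - 1, by simp at hn; omega⟩
      have := hg (n + 1) hn
      rw [List.ofFn_succ] at this ⊢
      conv_lhs => rw [this]
      simp
  | cons_cons a _ ih =>
    obtain ⟨p₀, g, hg⟩ := ih
    refine ⟨p₀, fun i => Nat.casesOn i [] g, fun n hn => ?_⟩
    obtain ⟨n, rfl⟩ : ∃ m, n = m + 1 := ⟨n - 1, by simp at hn; omega⟩
    rw [List.ofFn_succ]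
    have := hg n (by simpa using hn)
    conv_lhs => rw [this]
    simp

theorem flatten_ofFn_getElem? {r : List α} {n : ℕ} (hn : r.length = n) :
    (List.ofFn fun i : Fin n => (r[(i : ℕ)]?).toList).flatten = r := by
  subst hn
  have : (List.ofFn fun i : Fin r.length => (r[(i : ℕ)]?).toList) = r.map fun a => [a] := by
    apply List.ext_getElem <;> simp
  rw [this]
  exact List.flatMap_singleton' r

/-- The value of a word under a substitution of lists for the letters. -/
def sub (f : Letter → List β) (u : Word) : List β := (FreeMonoid.toList u).flatMap f

variable (f : Letter → List β)

@[simp] theorem sub_mul (u v : Word) : sub f (u * v) = sub f u ++ sub f v := by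
  simp [sub]

@[simp] theorem sub_pow_two (u : Word) : sub f (u ^ 2) = sub f u ++ sub f u := by
  rw [pow_two, sub_mul]

@[simp] theorem sub_x : sub f x = f Letter.x := by simp [sub, x]

@[simp] theorem sub_y : sub f y = f Letter.y := by simp [sub, y]

@[simp] theorem sub_s : sub f s = f Letter.s := by simp [sub, s]

@[simp] theorem sub_t : sub f t = f Letter.t := by simp [sub, t]

@[simp] theorem sub_z (i : ℕ) : sub f (z i) = f (Letter.z i) := by simp [sub, z]

@[simp] theorem sub_ti (i : ℕ) : sub f (ti i) = f (Letter.ti i) := by simp [sub, ti]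

@[simp] theorem sub_wprod {n : ℕ} (u : Fin n → Word) :
    sub f (wprod u) = (List.ofFn fun i => sub f (u i)).flatten := by
  have : ∀ l : List Word, sub f l.prod = (l.map (sub f)).flatten := by
    intro l
    induction l with
    | nil => rfl
    | cons a l ih => simp [ih]
  rw [wprod, this, List.map_ofFn]
  rfl

/-- The relation `θ` contains the identity `e`. -/
def Has (θ : List Letter → List Letter → Prop) (e : Identity) : Prop :=
  θ (FreeMonoid.toList e.1) (FreeMonoid.toList e.2)

theorem Has.sub {θ : List Letter → List Letter → Prop} (F : Fic θ) {e : Identity} (H : Has θ e)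
    (f : Letter → List Letter) : θ (sub f e.1) (sub f e.2) :=
  F.subst H f

theorem toList_eq_sub (u : Word) : FreeMonoid.toList u = sub (fun a => [a]) u := by
  simp [sub]

end Words

/-! ### The identities of `A'` yield the laws of good congruences. -/

section Axioms

variable {θ : List Letter → List Letter → Prop}

noncomputable instance : DecidableEq Letter := Classical.decEq _

theorem Fic.cube_of_has (F : Fic θ) (H : ∀ e ∈ aIdentities, Has θ e) (a : List Letter) :
    θ (a ++ a) (a ++ (a ++ a)) := by
  have := (H (x ^ 2, x ^ 3) (by simp [aIdentities])).sub F fun _ => a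
  rw [pow_succ x 2] at this
  simpa using this

theorem Fic.central_of_has (F : Fic θ) (H : ∀ e ∈ aIdentities, Has θ e) (a b : List Letter) :
    θ (a ++ (a ++ b)) (b ++ (a ++ a)) := by
  have := (H (x ^ 2 * y, y * x ^ 2) (by simp [aIdentities])).sub F
    fun l => if l = Letter.x then a else b
  simpa using this

/-- The letters of `r` from `P` can be listed in the order in which they occur in `p`. -/
theorem dedup_filter_perm {r p : List Letter} (hr : r.Nodup) (P : Letter → Bool)
    (hP : ∀ a ∈ r, P a → a ∈ p) :
    (p.dedup.filter fun a => decide (a ∈ r) && P a).Perm (r.filter P) := by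
  rw [List.perm_ext_iff_of_nodup ((List.nodup_dedup p).filter _) (hr.filter _)]
  intro a
  simp only [List.mem_filter, List.mem_dedup, Bool.and_eq_true, decide_eq_true_eq]
  constructor
  · rintro ⟨_, h₂, h₃⟩; exact ⟨h₂, h₃⟩
  · rintro ⟨h₂, h₃⟩; exact ⟨hP a h₂ h₃, h₂, h₃⟩

theorem filter_dedup_sublist (p : List Letter) (P : Letter → Bool) : (p.dedup.filter P).Sublist p :=
  List.filter_sublist.trans (List.dedup_sublist p)

/-- Take n to be the length of `r`. A letter of `r` that occurs in `p` is the value of some z_j with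
j < n, any other one of some z_{n+j}; in each factor z_{iπ}z_{n+iτ} the unwanted member becomes
empty. -/
theorem Fic.collect_of_has (F : Fic θ) (H : ∀ e ∈ wIdentities, Has θ e) (p : List Letter)
    (X : Letter) (r q : List Letter) (hr : r.Nodup) (hm : ∀ a ∈ r, a ∈ p ∨ a ∈ q) :
    θ (p ++ X :: (r ++ X :: q)) (p ++ X :: X :: (r ++ q)) := by
  by_cases hr0 : r = []
  · subst hr0; exact F.refl _
  have hn : 1 ≤ r.length := by
    have := List.length_pos_iff.2 hr0; omega
  have h₁ := dedup_filter_perm (p := p) hr (fun a => decide (a ∈ p)) (by simp)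
  have h₂ := dedup_filter_perm (p := q) hr (fun a => !decide (a ∈ p)) (by
    intro a ha h; simp at h; exact (hm a ha).resolve_left h)
  obtain ⟨p₀, g₁, e₁⟩ := exists_interleave_right
    (filter_dedup_sublist p (fun a => decide (a ∈ r) && decide (a ∈ p)))
  obtain ⟨q₀, g₂, e₂⟩ := exists_interleave_left
    (filter_dedup_sublist q (fun a => decide (a ∈ r) && !decide (a ∈ p)))
  replace e₁ := e₁ r.length (by rw [h₁.length_eq]; exact List.length_filter_le _ _)
  replace e₂ := e₂ r.length (by rw [h₂.length_eq]; exact List.length_filter_le _ _)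
  obtain ⟨π, hπ⟩ := exists_perm_filter h₁
  obtain ⟨τ, hτ⟩ := exists_perm_filter h₂
  generalize (p.dedup.filter fun a => decide (a ∈ r) && decide (a ∈ p)) = L₁ at *
  generalize (q.dedup.filter fun a => decide (a ∈ r) && !decide (a ∈ p)) = L₂ at *
  let f : Letter → List Letter := fun l => match l with
    | Letter.z j => if j < r.length then (L₁[j]?).toList else (L₂[j - r.length]?).toList
    | Letter.ti j => if j < r.length then g₁ j else g₂ (j - r.length)
    | _ => [X]
  have key := F.context ((H _ ⟨r.length, π, τ, hn, rfl⟩).sub F f) p₀ q₀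
  have hmid : (List.ofFn fun i : Fin r.length =>
      (L₁[(π i : ℕ)]?).toList ++ (L₂[(τ i : ℕ)]?).toList).flatten = r := by
    conv_rhs => rw [← flatten_ofFn_getElem? (r := r) rfl]
    congr 2
    funext i
    rw [hπ, hτ]
    by_cases h : r[i] ∈ p <;> simp at h <;> simp [h]
  have hx : f Letter.x = [X] := rfl
  simp [w, w', f, hmid] at key
  rw [← List.append_assoc p₀, ← List.append_assoc p₀, ← e₁, ← e₂] at key
  exact key

theorem Fic.exchange_of_has (F : Fic θ) {n m k : ℕ}
    (H : ∀ ρ, Has θ (c n m k ρ, c' n m k ρ)) (X Y : Letter) {L₁ L₂ L₃ p q r v : List Letter}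
    (h₁ : L₁.Sublist p) (h₂ : L₂.Sublist q) (h₃ : L₃.Sublist v) (l₁ : L₁.length = n)
    (l₂ : L₂.length = m) (l₃ : L₃.length = k) (hr : (L₁ ++ L₂ ++ L₃).Perm r) :
    θ (p ++ X :: Y :: (q ++ X :: (r ++ Y :: v))) (p ++ Y :: X :: (q ++ X :: (r ++ Y :: v))) := by
  obtain ⟨p₀, g₁, e₁⟩ := exists_interleave_right h₁
  obtain ⟨q₀, g₂, e₂⟩ := exists_interleave_right h₂
  obtain ⟨v₀, g₃, e₃⟩ := exists_interleave_left h₃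
  replace e₁ := e₁ n l₁.le
  replace e₂ := e₂ m l₂.le
  replace e₃ := e₃ k l₃.le
  have hlen : r.length = n + m + k := by rw [← hr.length_eq]; simp [l₁, l₂, l₃]; omega
  obtain ⟨ρ, hρ⟩ := exists_perm_of_list_perm hr (n + m + k) (by rw [hr.length_eq, hlen])
  obtain ⟨L, hL⟩ : ∃ L, L = L₁ ++ L₂ ++ L₃ := ⟨_, rfl⟩
  rw [← hL] at hρ
  let f : Letter → List Letter := fun l => match l with
    | Letter.z j => (L[j]?).toList
    | Letter.ti j => if j < n then g₁ j else if j < n + m then g₂ (j - n) else g₃ (j - n - m)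
    | Letter.x => [X]
    | Letter.y => [Y]
    -- This fixes the value of `t`, which stands in front of the middle product and so takes the
    -- initial remainder of `q`.
    | _ => q₀
  have key := F.context ((H ρ).sub F f) p₀ v₀
  have hmid : (List.ofFn fun i : Fin (n + m + k) =>
      ((L[(ρ i : ℕ)]?).toList)).flatten = r := by
    simp only [hρ]
    exact flatten_ofFn_getElem? hlen
  have hz₁ : ∀ i : Fin n, L[(i : ℕ)]? = L₁[(i : ℕ)]? := by
    intro i
    rw [hL, List.append_assoc, List.getElem?_append_left (by omega)]
  have hz₂ : ∀ i : Fin m, L[n + (i : ℕ)]? = L₂[(i : ℕ)]? := by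
    intro i
    rw [hL, List.append_assoc, List.getElem?_append_right (by omega),
      List.getElem?_append_left (by omega)]
    congr 1; omega
  have hz₃ : ∀ i : Fin k, L[n + m + (i : ℕ)]? = L₃[(i : ℕ)]? := by
    intro i
    rw [hL, List.getElem?_append_right (by simp; omega)]
    congr 1; simp; omega
  have ht₃ : ∀ i : Fin k, f (Letter.ti (n + m + i)) = g₃ i := by
    intro i
    simp only [f]
    rw [if_neg (by omega), if_neg (by omega)]
    congr 1; omega
  have ht₂ : ∀ i : Fin m, f (Letter.ti (n + i)) = g₂ i := by
    intro i
    simp [f]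
  have ht₁ : ∀ i : Fin n, f (Letter.ti i) = g₁ i := by
    intro i
    simp [f]
  have hz : ∀ j, f (Letter.z j) = (L[j]?).toList := fun _ => rfl
  have hx : f Letter.x = [X] := rfl
  have hy : f Letter.y = [Y] := rfl
  have ht : f Letter.t = q₀ := rfl
  simp only [c, c', sub_mul, sub_wprod, sub_x, sub_y, sub_t, sub_z, sub_ti, hz, hz₁, hz₂, hz₃,
    ht₁, ht₂, ht₃, hx, hy, ht, hmid, List.append_assoc, List.cons_append, List.nil_append] at key
  rw [← List.append_assoc p₀, ← List.append_assoc p₀, ← e₁, ← e₃, ← List.append_assoc q₀,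
    ← e₂] at key
  exact key

/-- The letters of `r` are split by the first of `p`, `q`, `v` in which they occur; the sizes of the
parts are n, m and k. -/
theorem Fic.exchange_left_of_has (F : Fic θ) (H : ∀ e ∈ cIdentities, Has θ e) (p : List Letter)
    (X Y : Letter) (q r v : List Letter) (hr : r.Nodup) (hm : ∀ a ∈ r, a ∈ p ∨ a ∈ q ∨ a ∈ v) :
    θ (p ++ X :: Y :: (q ++ X :: (r ++ Y :: v))) (p ++ Y :: X :: (q ++ X :: (r ++ Y :: v))) := by
  have h₁ := dedup_filter_perm (p := p) hr (fun a => decide (a ∈ p)) (by simp)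
  have h₂ := dedup_filter_perm (p := q) hr (fun a => !decide (a ∈ p) && decide (a ∈ q)) (by simp)
  have h₃ := dedup_filter_perm (p := v) hr (fun a => !decide (a ∈ p) && !decide (a ∈ q)) (by
    intro a ha h; simp at h; exact ((hm a ha).resolve_left h.1).resolve_left h.2)
  refine F.exchange_of_has (fun ρ => H _ ⟨_, _, _, ρ, rfl⟩) X Y
    (filter_dedup_sublist p _) (filter_dedup_sublist q _) (filter_dedup_sublist v _) rfl rfl rfl
    (((h₁.append h₂).append h₃).trans ?_)
  rw [List.perm_iff_count]
  intro a
  simp only [List.count_append]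
  have h0 : ∀ P : Letter → Bool, P a = false → (r.filter P).count a = 0 := fun P h =>
    List.count_eq_zero.2 (by simp [h])
  have h1 : ∀ P : Letter → Bool, P a = true → (r.filter P).count a = r.count a := fun P h =>
    List.count_filter h
  by_cases ha : a ∈ p
  · rw [h1 _ (by simp [ha]), h0 _ (by simp [ha]), h0 _ (by simp [ha])]
    omega
  · by_cases ha' : a ∈ q
    · rw [h0 _ (by simp [ha]), h1 _ (by simp [ha, ha']), h0 _ (by simp [ha, ha'])]
      omega
    · rw [h0 _ (by simp [ha]), h0 _ (by simp [ha, ha']), h1 _ (by simp [ha, ha'])]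
      omega

/-- The dual of a relation. -/
def dual (θ : List Letter → List Letter → Prop) : List Letter → List Letter → Prop :=
  fun a b => θ a.reverse b.reverse

theorem Fic.dual (F : Fic θ) : Fic (dual θ) where
  refl _ := F.refl _
  symm h := F.symm h
  trans h k := F.trans h k
  append h k := by
    unfold MonVar.dual
    rw [List.reverse_append, List.reverse_append]
    exact F.append k h
  subst {a b} h f := by
    have := F.subst (f := fun a => (f a).reverse) h
    unfold MonVar.dual
    rw [List.reverse_flatMap, List.reverse_flatMap]
    exact this

theorem has_dual {e : Identity} : Has θ e.dual ↔ Has (dual θ) e := Iff.rfl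

/-- The defining identities of `A'`. -/
def a'Identities : Set Identity := aIdentities ∪ wIdentities ∪ (cIdentities ∪ dIdentities)

theorem good_of_has (F : Fic θ) (H : ∀ e ∈ a'Identities, Has θ e) : Good θ where
  toFic := F
  cube := F.cube_of_has fun e he => H e (Or.inl (Or.inl he))
  central := F.central_of_has fun e he => H e (Or.inl (Or.inl he))
  collect := F.collect_of_has fun e he => H e (Or.inl (Or.inr he))
  exchange_left := F.exchange_left_of_has fun e he => H e (Or.inr (Or.inl he))
  exchange_right p X Y q r v hr hm := by
    have := F.dual.exchange_left_of_has (fun e he => has_dual.1 (H e.dual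
      (Or.inr (Or.inr ⟨e, he, rfl⟩)))) p.reverse X Y q.reverse r.reverse v.reverse
      (by simpa using hr) (by simpa using hm)
    simpa [dual] using this

end Axioms

/-! ### Equational theories, prime identities and distributivity. -/

section Varieties

/-- The equational theory of a variety. -/
def MonoidVariety.rel (V : MonoidVariety.{u}) (a b : List Letter) : Prop :=
  V.Models (FreeMonoid.ofList a, FreeMonoid.ofList b)

theorem lift_flatMap {M : Type*} [Monoid M] (g : Letter → M) (f : Letter → List Letter)
    (a : List Letter) : FreeMonoid.lift g (FreeMonoid.ofList (a.flatMap f)) =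
      FreeMonoid.lift (fun l => FreeMonoid.lift g (FreeMonoid.ofList (f l)))
        (FreeMonoid.ofList a) := by
  induction a with
  | nil => rfl
  | cons c a ih =>
    rw [List.flatMap_cons, FreeMonoid.ofList_append, FreeMonoid.ofList_cons, map_mul, map_mul, ih,
      FreeMonoid.lift_eval_of]

theorem MonoidVariety.fic (V : MonoidVariety.{u}) : Fic V.rel where
  refl _ _ _ _ _ := rfl
  symm h M _ hM f := (h M hM f).symm
  trans h k M _ hM f := (h M hM f).trans (k M hM f)
  append h k M _ hM f := by
    have h₁ := h M hM f
    have h₂ := k M hM f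
    simp only [FreeMonoid.ofList_append, map_mul] at h₁ h₂ ⊢
    rw [h₁, h₂]
  subst h f M _ hM g := by
    have := h M hM fun l => FreeMonoid.lift g (FreeMonoid.ofList (f l))
    simp only [lift_flatMap]
    exact this

theorem MonoidVariety.mem_iff (V : MonoidVariety.{u}) (M : Type u) [Monoid M] :
    V.Mem M ↔ ∀ e, V.Models e → Satisfies M e := by
  refine ⟨fun h e he => he M h, fun h => ?_⟩
  obtain ⟨S, hS⟩ := V.equational
  rw [hS]
  exact fun e he => h e fun N _ hN => (hS N).1 hN e he

/-- The congruence on the free monoid that corresponds to `θ`. -/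
def Fic.con {θ : List Letter → List Letter → Prop} (F : Fic θ) : Con (FreeMonoid Letter) where
  r a b := θ (FreeMonoid.toList a) (FreeMonoid.toList b)
  iseqv := ⟨fun _ => F.refl _, F.symm, F.trans⟩
  mul' := F.append

/-- Each fully invariant congruence is the set of identities of a monoid. -/
theorem Fic.exists_monoid {θ : List Letter → List Letter → Prop} (F : Fic θ) :
    ∃ (M : Type u) (_ : Monoid M), ∀ e, Satisfies M e ↔ Has θ e := by
  have key : ∀ (g : Letter → List Letter) (a : FreeMonoid Letter),
      FreeMonoid.lift (fun l => (ULift.up ((FreeMonoid.ofList (g l) : FreeMonoid Letter) :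
        F.con.Quotient) : ULift.{u} F.con.Quotient)) a =
      ULift.up ((FreeMonoid.ofList ((FreeMonoid.toList a).flatMap g) : FreeMonoid Letter) :
        F.con.Quotient) := by
    intro g a
    induction a using FreeMonoid.inductionOn' with
    | one => rfl
    | of_mul l a ih =>
      rw [map_mul, ih, FreeMonoid.lift_eval_of, FreeMonoid.toList_of_mul, List.flatMap_cons,
        FreeMonoid.ofList_append, Con.coe_mul]
      rfl
  refine ⟨ULift.{u} F.con.Quotient, inferInstance, fun e => ⟨fun h => ?_, fun h f => ?_⟩⟩
  · have := h fun l => ULift.up ((FreeMonoid.ofList [l] : FreeMonoid Letter) : F.con.Quotient)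
    rw [key, key] at this
    have := (Con.eq F.con).1 (ULift.up_injective this)
    simp only [List.flatMap_singleton', FreeMonoid.ofList_toList] at this
    exact this
  · have hrep : ∀ l, ∃ a : List Letter,
        f l = ULift.up ((FreeMonoid.ofList a : FreeMonoid Letter) : F.con.Quotient) := by
      intro l
      obtain ⟨b, hb⟩ := Quotient.exists_rep (f l).down
      exact ⟨FreeMonoid.toList b, ULift.ext _ _ hb.symm⟩
    choose g hg using hrep
    have hf : f = fun l => ULift.up ((FreeMonoid.ofList (g l) : FreeMonoid Letter) :
        F.con.Quotient) := funext hg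
    rw [hf, key, key]
    exact congrArg ULift.up ((Con.eq F.con).2 (F.subst h g))

theorem mem_A'_iff (M : Type u) [Monoid M] : A'.Mem M ↔ ∀ e ∈ a'Identities, Satisfies M e := by
  constructor
  · rintro ⟨⟨h₁, h₂⟩, h₃⟩ e ((he | he) | he)
    · exact h₁ e he
    · exact h₂ e he
    · exact h₃ e he
  · intro h
    exact ⟨⟨fun e he => h e (Or.inl (Or.inl he)), fun e he => h e (Or.inl (Or.inr he))⟩,
      fun e he => h e (Or.inr he)⟩

theorem le_A'_of_has {V : MonoidVariety.{u}} (H : ∀ e ∈ a'Identities, Has V.rel e) :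
    V ≤ A' := by
  intro M _ hM
  rw [mem_A'_iff]
  exact fun e he => H e he M hM

theorem MonoidVariety.good {V : MonoidVariety.{u}} (H : V ≤ A') : Good V.rel :=
  good_of_has V.fic fun e he M _ hM => (mem_A'_iff M).1 (H M hM) e he

/-- The identities of the intersection of two varieties are derived from the identities of both. -/
theorem rel_or_rel_of_prime {V W : MonoidVariety.{u}} (hV : V ≤ A') (hW : W ≤ A')
    {a b : List Letter} (hp : Prime a b) (H : (V ⊓ W).rel a b) : V.rel a b ∨ W.rel a b := by
  -- The transitive closure of the union is a fully invariant congruence containing both theories;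
  -- its monoid lies in V ⊓ W, so each identity of V ⊓ W has a derivation whose steps belong to V or
  -- to W.
  let r : List Letter → List Letter → Prop := fun a b => V.rel a b ∨ W.rel a b
  have F : Fic (Relation.ReflTransGen r) :=
    { refl := fun _ => Relation.ReflTransGen.refl
      symm := by
        intro a b h
        have : Std.Symm r := ⟨fun a b h => h.imp V.fic.symm W.fic.symm⟩
        exact Relation.ReflTransGen.stdSymm.symm a b h
      trans := Relation.ReflTransGen.trans
      append := by
        intro a b c d h k
        refine Relation.ReflTransGen.trans (b := b ++ c) ?_ ?_
        · exact h.lift (· ++ c) fun _ _ h =>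
            h.imp (fun h => V.fic.append h (V.fic.refl c)) fun h => W.fic.append h (W.fic.refl c)
        · exact k.lift (b ++ ·) fun _ _ h =>
            h.imp (fun h => V.fic.append (V.fic.refl b) h) fun h => W.fic.append (W.fic.refl b) h
      subst := fun h f => h.lift _ fun _ _ h => h.imp (V.fic.subst · f) (W.fic.subst · f) }
  obtain ⟨M, hM, hs⟩ := F.exists_monoid.{u}
  have hmem : (V ⊓ W).Mem M :=
    ⟨(V.mem_iff M).2 fun e he => (hs e).2 (Relation.ReflTransGen.single (Or.inl he)),
      (W.mem_iff M).2 fun e he => (hs e).2 (Relation.ReflTransGen.single (Or.inr he))⟩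
  have hab : Relation.ReflTransGen r a b := (hs _).1 (H M hmem)
  by_contra hcon
  -- If neither variety satisfies the prime identity, no step of a derivation can leave `a`.
  have hst : ∀ c, Relation.ReflTransGen r a c → a = c := by
    intro c hc
    induction hc with
    | refl => rfl
    | tail _ h ih =>
      subst ih
      by_contra hne
      exact hcon (h.imp (fun h => hp _ (MonoidVariety.good hV) _ h hne)
        fun h => hp _ (MonoidVariety.good hW) _ h hne)
  rw [← hst b hab] at hcon
  exact hcon (Or.inl (V.fic.refl a))

instance : Nontrivial Letter := ⟨Letter.x, Letter.y, by simp⟩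

theorem le_of_rel_of_prime {V W : MonoidVariety.{u}} (hV : V ≤ A') (hW : W ≤ A')
    (H : ∀ a b, Prime a b → W.rel a b → V.rel a b) : V ≤ W := by
  intro M _ hM
  rw [W.mem_iff]
  intro e he
  exact le_of_prime (MonoidVariety.good hW) (MonoidVariety.good hV) H he M hM

/-- A prime identity of the right side holds in X or Y, and also in X or Z; hence it holds in X, or
in both Y and Z. -/
theorem inf_sup_le {X Y Z : MonoidVariety.{u}} (hX : X ≤ A') (hY : Y ≤ A') (hZ : Z ≤ A') :
    X ⊓ (Y ⊔ Z) ≤ (X ⊓ Y) ⊔ (X ⊓ Z) := by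
  refine le_of_rel_of_prime (inf_le_left.trans hX)
    (sup_le (inf_le_left.trans hX) (inf_le_left.trans hX)) fun a b hp H => ?_
  have anti : ∀ {V W : MonoidVariety.{u}}, V ≤ W → W.rel a b → V.rel a b :=
    fun h k M _ hM => k M (h M hM)
  have h₁ := rel_or_rel_of_prime hX hY hp (anti le_sup_left H)
  have h₂ := rel_or_rel_of_prime hX hZ hp (anti le_sup_right H)
  rcases h₁ with h₁ | h₁
  · exact anti inf_le_left h₁
  rcases h₂ with h₂ | h₂
  · exact anti inf_le_left h₂
  · refine anti inf_le_right fun M _ hM => ?_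
    exact hM _ ⟨h₁, h₂⟩

end Varieties

/-! ### `R` and the varieties `Q r s` lie in `A'`. -/

section Derivations

variable {θ : List Letter → List Letter → Prop}

theorem has_w (H : ∀ p X r q, (∀ a ∈ r, a ∈ p ∨ a ∈ q) →
      θ (p ++ X :: (r ++ X :: q)) (p ++ X :: X :: (r ++ q))) :
    ∀ e ∈ wIdentities, Has θ e := by
  rintro _ ⟨n, π, τ, -, rfl⟩
  unfold Has
  rw [toList_eq_sub, toList_eq_sub]
  simp only [w, w', sub_mul, sub_wprod, sub_x, sub_z, sub_ti, sub_pow_two, List.append_assoc,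
    List.cons_append, List.nil_append]
  apply H
  intro a ha
  simp only [List.mem_flatten, List.mem_ofFn, exists_exists_eq_and, List.mem_cons,
    List.not_mem_nil, or_false] at ha ⊢
  obtain ⟨i, rfl | rfl⟩ := ha
  · exact Or.inl ⟨π i, Or.inl rfl⟩
  · exact Or.inr ⟨τ i, Or.inr rfl⟩

theorem has_c (H : ∀ p X Y q r v, r.Nodup → (∀ a ∈ r, a ∈ p ∨ a ∈ q ∨ a ∈ v) →
      θ (p ++ X :: Y :: (q ++ X :: (r ++ Y :: v))) (p ++ Y :: X :: (q ++ X :: (r ++ Y :: v)))) :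
    ∀ e ∈ cIdentities, Has θ e := by
  rintro _ ⟨n, m, k, ρ, rfl⟩
  unfold Has
  rw [toList_eq_sub, toList_eq_sub]
  simp only [c, c', sub_mul, sub_wprod, sub_x, sub_y, sub_t, sub_z, sub_ti, List.append_assoc,
    List.cons_append, List.nil_append]
  have hr : (List.ofFn fun i : Fin (n + m + k) => [Letter.z (ρ i)]).flatten =
      List.ofFn fun i : Fin (n + m + k) => Letter.z (ρ i) := by
    have : (List.ofFn fun i : Fin (n + m + k) => [Letter.z (ρ i)]) =
        (List.ofFn fun i : Fin (n + m + k) => Letter.z (ρ i)).map fun a => [a] := by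
      rw [List.map_ofFn]; rfl
    rw [this]
    exact List.flatMap_singleton' _
  rw [hr]
  refine H _ _ _ (Letter.t :: _) _ _ ?_ ?_
  · rw [List.nodup_ofFn]
    intro i j hij
    simp only [Letter.z.injEq] at hij
    exact ρ.injective (Fin.ext hij)
  · intro a ha
    simp only [List.mem_flatten, List.mem_ofFn, exists_exists_eq_and, List.mem_cons,
      List.not_mem_nil, or_false] at ha ⊢
    obtain ⟨i, rfl⟩ := ha
    have hlt := (ρ i).isLt
    by_cases h₁ : (ρ i : ℕ) < n
    · exact Or.inl ⟨⟨ρ i, h₁⟩, Or.inl rfl⟩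
    · by_cases h₂ : (ρ i : ℕ) < n + m
      · refine Or.inr (Or.inl (Or.inr ⟨⟨ρ i - n, by omega⟩, Or.inl ?_⟩))
        simp only [Letter.z.injEq]; omega
      · refine Or.inr (Or.inr ⟨⟨ρ i - (n + m), by omega⟩, Or.inr ?_⟩)
        simp only [Letter.z.injEq]; omega

theorem has_a'Identities (ha : ∀ e ∈ aIdentities, Has θ e) (hw : ∀ e ∈ wIdentities, Has θ e)
    (hc : ∀ e ∈ cIdentities, Has θ e) (hd : ∀ e ∈ cIdentities, Has (dual θ) e) :
    ∀ e ∈ a'Identities, Has θ e := by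
  rintro e ((he | he) | (he | ⟨e, he, rfl⟩))
  · exact ha e he
  · exact hw e he
  · exact hc e he
  · exact has_dual.2 (hd e he)

theorem Fic.exchange_of_sigma₁ (F : Fic θ) (H : Has θ sigma₁) (p : List Letter) (X Y : Letter)
    (q r v : List Letter) :
    θ (p ++ X :: Y :: (q ++ X :: (r ++ Y :: v))) (p ++ Y :: X :: (q ++ X :: (r ++ Y :: v))) := by
  let f : Letter → List Letter := fun l => match l with
    | Letter.x => [X]
    | Letter.y => [Y]
    | Letter.s => q
    | _ => r
  have := F.context (H.sub F f) p v
  simpa [sigma₁, f] using this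

/-- In this form σ₃ exchanges an adjacent non-first occurrence of one letter and non-last occurrence
of another. -/
theorem Fic.swap_of_sigma₃ (F : Fic θ) (H : Has θ sigma₃) {p v : List Letter} {X Y : Letter}
    (hX : X ∈ p) (hY : Y ∈ v) : θ (p ++ X :: Y :: v) (p ++ Y :: X :: v) := by
  obtain ⟨p₁, p₂, rfl⟩ := List.append_of_mem hX
  obtain ⟨v₁, v₂, rfl⟩ := List.append_of_mem hY
  let f : Letter → List Letter := fun l => match l with
    | Letter.x => [X]
    | Letter.y => [Y]
    | Letter.s => p₂
    | _ => v₁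
  have := F.context (H.sub F f) p₁ v₂
  simpa [sigma₃, f] using this

theorem Fic.move_right (F : Fic θ) (H : Has θ sigma₃) {v : List Letter} {a : Letter} (ha : a ∈ v)
    (l : List Letter) : ∀ p : List Letter, (∀ b ∈ l, b ∈ p) →
      θ (p ++ a :: (l ++ v)) (p ++ (l ++ a :: v)) := by
  induction l with
  | nil => exact fun p _ => F.refl _
  | cons b l ih =>
    intro p hl
    refine F.trans (F.symm (F.swap_of_sigma₃ H (hl b (by simp)) (by simp [ha]))) ?_
    simpa using ih (p ++ [b]) fun d hd => by simp [hl d (by simp [hd])]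

theorem Fic.move_left (F : Fic θ) (H : Has θ sigma₃) {q : List Letter} {a : Letter}
    (l : List Letter) : ∀ p : List Letter, a ∈ p → (∀ b ∈ l, b ∈ q) →
      θ (p ++ (l ++ a :: q)) (p ++ a :: (l ++ q)) := by
  induction l with
  | nil => exact fun p _ _ => F.refl _
  | cons b l ih =>
    intro p ha hl
    have h₁ := ih (p ++ [b]) (by simp [ha]) fun d hd => hl d (by simp [hd])
    refine F.trans (by simpa using h₁) (F.symm (F.swap_of_sigma₃ H ha ?_))
    exact List.mem_append_right _ (hl b (by simp))

/-- Letters with an earlier occurrence are moved in front of those with a later one; σ₃ permits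
every transposition needed. -/
theorem Fic.sort (F : Fic θ) (H : Has θ sigma₃) (P : Letter → Bool) (q r : List Letter) :
    ∀ p : List Letter, (∀ a ∈ r, P a → a ∈ p) → (∀ a ∈ r, P a = false → a ∈ q) →
      θ (p ++ (r ++ q)) (p ++ (r.filter P ++ (r.filter (fun a => !P a) ++ q))) := by
  induction r with
  | nil => exact fun p _ _ => F.refl _
  | cons a r ih =>
    intro p h₁ h₂
    have h₃ := ih (p ++ [a]) (fun b hb hPb => by simp [h₁ b (by simp [hb]) hPb])
      fun b hb => h₂ b (by simp [hb])
    by_cases ha : P a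
    · simpa [ha] using h₃
    · have ha : P a = false := by simpa using ha
      have h₄ := F.move_right H (v := r.filter (fun a => !P a) ++ q) (a := a)
        (List.mem_append_right _ (h₂ a (by simp) ha)) (r.filter P) p fun b hb => by
          rw [List.mem_filter] at hb
          exact h₁ b (by simp [hb.1]) hb.2
      simpa [ha] using F.trans (by simpa using h₃) h₄

/-- After sorting `r`, the first `X` passes to the right over the letters known from `p`, the second
to the left over those recurring in `q`. The square so formed is central and moves to the front, and
the sorting is undone. -/
theorem Fic.collect_of_sigma₃ (F : Fic θ) (Ha : ∀ e ∈ aIdentities, Has θ e) (H : Has θ sigma₃)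
    (p : List Letter) (X : Letter) (r q : List Letter) (hm : ∀ a ∈ r, a ∈ p ∨ a ∈ q) :
    θ (p ++ X :: (r ++ X :: q)) (p ++ X :: X :: (r ++ q)) := by
  let P : Letter → Bool := fun a => decide (a ∈ p)
  have hP : ∀ a ∈ r, P a → a ∈ p := fun a _ h => by simpa [P] using h
  have hP' : ∀ a ∈ r, P a = false → a ∈ q := fun a ha h =>
    (hm a ha).resolve_left (by simpa [P] using h)
  have h₁ := F.sort H P (X :: q) r (p ++ [X]) (fun a ha h => by simp [hP a ha h])
    fun a ha h => by simp [hP' a ha h]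
  have h₂ := F.move_right H (v := r.filter (fun a => !P a) ++ X :: q) (a := X) (by simp)
    (r.filter P) p fun b hb => by rw [List.mem_filter] at hb; exact hP b hb.1 hb.2
  have h₃ := F.move_left H (q := q) (a := X) (r.filter fun a => !P a) (p ++ r.filter P ++ [X])
    (by simp) fun b hb => by
      rw [List.mem_filter] at hb; exact hP' b hb.1 (by simpa using hb.2)
  have h₄ := F.context (F.symm (F.central_of_has Ha [X] (r.filter P))) p
    (r.filter (fun a => !P a) ++ q)
  have h₅ := F.sort H P q r (p ++ [X, X]) (fun a ha h => by simp [hP a ha h]) hP'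
  simp only [List.append_assoc, List.cons_append, List.nil_append] at h₁ h₂ h₃ h₄ h₅
  exact F.trans h₁ (F.trans h₂ (F.trans h₃ (F.trans h₄ (F.symm h₅))))

/-- The second `Y` moves left over the letters of `r` that recur only in `v`. Between `X` and `Y`
there remain letters from `p` and `q`, which is the case k = 0. -/
theorem Fic.exchange_of_sigma₃ (F : Fic θ) (H : Has θ sigma₃) (Hc : ∀ e ∈ c₂Identities, Has θ e)
    (p : List Letter) (X Y : Letter) (q r v : List Letter) (hr : r.Nodup)
    (hm : ∀ a ∈ r, a ∈ p ∨ a ∈ q ∨ a ∈ v) :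
    θ (p ++ X :: Y :: (q ++ X :: (r ++ Y :: v))) (p ++ Y :: X :: (q ++ X :: (r ++ Y :: v))) := by
  let P : Letter → Bool := fun a => decide (a ∈ p) || decide (a ∈ q)
  have hP : ∀ a ∈ r, P a → a ∈ p ∨ a ∈ q := fun a _ h => by simpa [P] using h
  have hP' : ∀ a ∈ r, P a = false → a ∈ v := fun a ha h => by
    simp [P] at h
    exact ((hm a ha).resolve_left h.1).resolve_left h.2
  have key : ∀ d : List Letter, Y ∈ d → (∀ a, a ∈ p ∨ a ∈ q → a ∈ d) →
      θ (d ++ (r ++ Y :: v)) (d ++ (r.filter P ++ Y :: (r.filter (fun a => !P a) ++ v))) := by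
    intro d hd hd'
    have h₁ := F.sort H P (Y :: v) r d (fun a ha h => hd' a (hP a ha h))
      fun a ha h => by simp [hP' a ha h]
    have h₂ := F.move_left H (q := v) (a := Y) (r.filter fun a => !P a) (d ++ r.filter P)
      (by simp [hd]) fun b hb => by
        rw [List.mem_filter] at hb; exact hP' b hb.1 (by simpa using hb.2)
    simp only [List.append_assoc] at h₂
    exact F.trans h₁ h₂
  have hc : ∀ n m (ρ : Equiv.Perm (Fin (n + m + 0))), Has θ (c n m 0 ρ, c' n m 0 ρ) := by
    intro n m ρ
    have := Hc _ ⟨n, m, ρ, rfl⟩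
    simpa [c, c', c₂, c₂', wprod] using this
  have hr' := hr.filter P
  have h₁ := dedup_filter_perm (p := p) hr' (fun a => decide (a ∈ p)) (by simp)
  have h₂ := dedup_filter_perm (p := q) hr' (fun a => !decide (a ∈ p)) (by
    intro a ha h
    rw [List.mem_filter] at ha
    exact (hP a ha.1 ha.2).resolve_left (by simpa using h))
  have h₃ := F.exchange_of_has (hc _ _) X Y (r := r.filter P)
    (filter_dedup_sublist p _) (filter_dedup_sublist q _)
    (List.nil_sublist (r.filter (fun a => !P a) ++ v)) rfl rfl rfl (by
      rw [List.append_nil]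
      exact (h₁.append h₂).trans (List.filter_append_perm _ _))
  have e : ∀ a b, p ++ a :: b :: (q ++ X :: (r ++ Y :: v)) =
      (p ++ a :: b :: (q ++ [X])) ++ (r ++ Y :: v) := by simp
  have h₄ := key (p ++ X :: Y :: (q ++ [X])) (by simp) (by intro a ha; simp; tauto)
  have h₅ := key (p ++ Y :: X :: (q ++ [X])) (by simp) (by intro a ha; simp; tauto)
  rw [e, e]
  refine F.trans h₄ (F.trans ?_ (F.symm h₅))
  simpa using h₃

theorem rel_var {S : Set Identity} {e : Identity} (he : e ∈ S) : Has (var.{u} S).rel e :=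
  fun _ _ hM => hM e he

theorem R_le : R.{u} ≤ A' := by
  have F := (R.{u}).fic
  have ha : ∀ e ∈ aIdentities, Has (R.{u}).rel e := fun e he => rel_var (Or.inl (Or.inl he))
  have h₁ : Has (R.{u}).rel sigma₁ := rel_var (Or.inl (Or.inr (Or.inl rfl)))
  have h₂ : Has (R.{u}).rel sigma₂ := rel_var (Or.inl (Or.inr (Or.inr rfl)))
  have h₃ : Has (dual (R.{u}).rel) sigma₁ := by
    -- Exchanging x with y and s with t turns σ₂ into the dual of σ₁.
    let f : Letter → List Letter := fun l => match l with
      | Letter.x => [Letter.y]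
      | Letter.y => [Letter.x]
      | Letter.s => [Letter.t]
      | _ => [Letter.s]
    have := h₂.sub F f
    simp only [sigma₂, sub_mul, sub_x, sub_y, sub_s, sub_t] at this
    exact this
  refine le_A'_of_has (has_a'Identities ha (fun e he => rel_var (Or.inr he)) ?_ ?_)
  · exact has_c fun p X Y q r v _ _ => F.exchange_of_sigma₁ h₁ p X Y q r v
  · exact has_c fun p X Y q r v _ _ => F.dual.exchange_of_sigma₁ h₃ p X Y q r v

theorem Q_le (i j : Fin 3) : Q.{u} i j ≤ A' := by
  have F := (Q.{u} i j).fic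
  have ha : ∀ e ∈ aIdentities, Has (Q.{u} i j).rel e := fun e he =>
    rel_var (Or.inl (Or.inl (Or.inl (Or.inl (Or.inl he)))))
  have h₁ : Has (Q.{u} i j).rel sigma₃ :=
    rel_var (Or.inl (Or.inl (Or.inl (Or.inl (Or.inr rfl)))))
  have h₂ : Has (dual (Q.{u} i j).rel) sigma₃ := by
    -- Under this renaming σ₃ is self-dual.
    let f : Letter → List Letter := fun l => match l with
      | Letter.x => [Letter.y]
      | Letter.y => [Letter.x]
      | Letter.s => [Letter.t]
      | _ => [Letter.s]
    have := h₁.sub F f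
    simp only [sigma₃, sub_mul, sub_x, sub_y, sub_s, sub_t] at this
    exact this
  have hc : ∀ e ∈ c₂Identities, Has (Q.{u} i j).rel e := fun e he =>
    rel_var (Or.inl (Or.inr he))
  have hd : ∀ e ∈ c₂Identities, Has (dual (Q.{u} i j).rel) e := fun e he =>
    has_dual.1 (rel_var (Or.inr ⟨e, he, rfl⟩))
  refine le_A'_of_has (has_a'Identities ha ?_ ?_ ?_)
  · exact has_w (F.collect_of_sigma₃ ha h₁)
  · exact has_c (F.exchange_of_sigma₃ h₁ hc)
  · exact has_c (F.dual.exchange_of_sigma₃ h₂ hd)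

end Derivations

/-! ### Isoterms for `A'` and properness of the inclusions. -/

section Isoterms

variable {β : Type*}

/-- The identities of the Rees quotient monoid given by the factors of the word `W`. -/
def factorRel (W : List β) (a b : List Letter) : Prop :=
  ∀ (f : Letter → List β) (p q : List β),
    p ++ (a.flatMap f ++ q) = W ↔ p ++ (b.flatMap f ++ q) = W

theorem factorRel_fic (W : List β) : Fic (factorRel W) where
  refl _ _ _ _ := Iff.rfl
  symm h f p q := (h f p q).symm
  trans h k f p q := (h f p q).trans (k f p q)
  append {a b c d} h k f p q := by
    have h₁ := h f p (c.flatMap f ++ q)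
    have h₂ := k f (p ++ b.flatMap f) q
    simp only [List.flatMap_append, List.append_assoc] at h₁ h₂ ⊢
    exact h₁.trans h₂
  subst h f g p q := by
    simp only [List.flatMap_assoc]
    exact h _ p q

theorem factorRel_reverse {W : List β} {a b : List Letter} (h : factorRel W.reverse a b) :
    dual (factorRel W) a b := by
  intro f p q
  have := h (fun l => (f l).reverse) q.reverse p.reverse
  rw [← List.reverse_inj, ← List.reverse_inj (xs := p ++ _)]
  rw [List.flatMap_reverse, List.flatMap_reverse]
  simpa [Function.comp_def] using this

variable [DecidableEq β]

/-- Between two occurrences of a letter there is a simple letter, and so is between two letters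
which are adjacent at an earlier place. -/
structure Separated (W : List β) : Prop where
  single : ∀ p e m q, W = p ++ e :: (m ++ e :: q) → ∃ b ∈ m, W.count b = 1
  pair : ∀ p e f k m q, W = p ++ e :: f :: (k ++ e :: (m ++ f :: q)) → ∃ b ∈ m, W.count b = 1
  pair' : ∀ p e f k m q, W = p ++ e :: f :: (k ++ f :: (m ++ e :: q)) → ∃ b ∈ m, W.count b = 1

theorem two_le_count {W p m q l k : List β} {b : β} (hb : b ∈ l) (hb' : b ∈ k)
    (e : W = p ++ (l ++ (m ++ (k ++ q)))) : W.count b ≠ 1 := by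
  have h₁ := List.count_pos_iff.2 hb
  have h₂ := List.count_pos_iff.2 hb'
  rw [e]
  simp only [List.count_append]
  omega

/-- The first letter of `l` recurs, so a simple letter lies in between; it is not in `l`, which
occurs twice, nor in `m`. -/
theorem Separated.square {W : List β} (H : Separated W) {p l m q : List β} (hl : l ≠ [])
    (hm : ∀ b ∈ m, W.count b ≠ 1) : p ++ (l ++ (m ++ (l ++ q))) ≠ W := by
  intro e
  cases l with
  | nil => exact hl rfl
  | cons d l =>
    obtain ⟨b, hb, hb'⟩ := H.single p d (l ++ m) (l ++ q) (by rw [← e]; simp)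
    rcases List.mem_append.1 hb with hb | hb
    · exact two_le_count (l := d :: l) (k := d :: l) (by simp [hb]) (by simp [hb]) e.symm hb'
    · exact hm b hb hb'

theorem Separated.square' {W : List β} (H : Separated W) {p l q : List β} (hl : l ≠ []) :
    p ++ (l ++ (l ++ q)) ≠ W := by
  simpa using H.square (p := p) (m := []) (q := q) hl (by simp)

theorem factorRel_aIdentities {W : List β} (H : Separated W) :
    ∀ e ∈ aIdentities, Has (factorRel W) e := by
  intro e he
  have hs : ∀ (f : Letter → List β) (u : Word), (FreeMonoid.toList u).flatMap f = sub f u :=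
    fun _ _ => rfl
  rcases he with rfl | he
  · intro f p q
    simp only [hs, pow_succ x 2, sub_mul, sub_pow_two, sub_x, List.append_assoc]
    by_cases hx : f Letter.x = []
    · simp [hx]
    · exact iff_of_false (H.square' hx) (H.square' hx)
  · rw [Set.mem_singleton_iff] at he
    subst he
    intro f p q
    simp only [hs, sub_mul, sub_pow_two, sub_x, sub_y, List.append_assoc]
    by_cases hx : f Letter.x = []
    · simp [hx]
    · refine iff_of_false (H.square' hx) ?_
      rw [← List.append_assoc]
      exact H.square' hx

/-- Unless the image of `X` is empty, neither side has an image that is a factor of `W`: every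
letter in the image of `r` occurs a second time, so no simple letter separates the two images of
`X`. -/
theorem factorRel_collect {W : List β} (H : Separated W) (p : List Letter) (X : Letter)
    (r q : List Letter) (hm : ∀ a ∈ r, a ∈ p ∨ a ∈ q) :
    factorRel W (p ++ X :: (r ++ X :: q)) (p ++ X :: X :: (r ++ q)) := by
  intro f p' q'
  simp only [List.flatMap_append, List.flatMap_cons, List.append_assoc]
  by_cases hx : f X = []
  · simp [hx]
  refine iff_of_false ?_ ?_
  · intro e
    rw [← List.append_assoc] at e
    refine H.square hx ?_ e
    intro b hb
    obtain ⟨a, ha, hba⟩ := List.mem_flatMap.1 hb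
    rcases hm a ha with hp | hq
    · refine two_le_count (p := p') (l := p.flatMap f) (m := f X) (k := r.flatMap f)
        (List.mem_flatMap.2 ⟨a, hp, hba⟩) hb (by rw [← e]; simp; rfl)
    · refine two_le_count (p := p' ++ p.flatMap f ++ f X) (l := r.flatMap f) (m := f X)
        (k := q.flatMap f) hb (List.mem_flatMap.2 ⟨a, hq, hba⟩) (by rw [← e]; simp; rfl)
  · rw [← List.append_assoc]
    exact H.square' hx

theorem factorRel_exchange {W : List β} (H : Separated W) (p : List Letter) (X Y : Letter)
    (q r v : List Letter) (hm : ∀ a ∈ r, a ∈ p ∨ a ∈ q ∨ a ∈ v) :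
    factorRel W (p ++ X :: Y :: (q ++ X :: (r ++ Y :: v)))
      (p ++ Y :: X :: (q ++ X :: (r ++ Y :: v))) := by
  intro f p' q'
  simp only [List.flatMap_append, List.flatMap_cons, List.append_assoc]
  cases hX : f X with
  | nil => simp
  | cons d₁ X₁ =>
  rcases List.eq_nil_or_concat' (f Y) with hY | ⟨Y₂, d₂, hY⟩
  · simp [hY]
  obtain ⟨X₂, d₃, hX'⟩ : ∃ X₂ d₃, d₁ :: X₁ = X₂ ++ [d₃] :=
    (List.eq_nil_or_concat' _).resolve_left (by simp)
  obtain ⟨d₄, Y₁, hY'⟩ : ∃ d₄ Y₁, f Y = d₄ :: Y₁ := by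
    cases hh : f Y with
    | nil => simp [hh] at hY
    | cons d l => exact ⟨d, l, rfl⟩
  have mult : ∀ (A B : List β), A ++ (B ++ (q.flatMap f ++ ((d₁ :: X₁) ++ (r.flatMap f ++
      (f Y ++ (v.flatMap f ++ q')))))) = W → (∀ b ∈ p.flatMap f, b ∈ A) →
      ∀ b ∈ r.flatMap f, W.count b ≠ 1 := by
    intro A B e hA b hb
    obtain ⟨a, ha, hba⟩ := List.mem_flatMap.1 hb
    rcases hm a ha with hp | hq | hv
    · exact two_le_count (p := []) (l := A) (m := B ++ (q.flatMap f ++ (d₁ :: X₁)))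
        (k := r.flatMap f) (hA b (List.mem_flatMap.2 ⟨a, hp, hba⟩)) hb (by rw [← e]; simp; rfl)
    · exact two_le_count (p := A ++ B) (l := q.flatMap f) (m := d₁ :: X₁) (k := r.flatMap f)
        (List.mem_flatMap.2 ⟨a, hq, hba⟩) hb (by rw [← e]; simp; rfl)
    · exact two_le_count (p := A ++ B ++ q.flatMap f ++ (d₁ :: X₁)) (l := r.flatMap f) (m := f Y)
        (k := v.flatMap f) hb (List.mem_flatMap.2 ⟨a, hv, hba⟩) (by rw [← e]; simp; rfl)
  refine iff_of_false ?_ ?_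
  · intro e
    have hr := mult (p' ++ p.flatMap f) ((d₁ :: X₁) ++ f Y) (by rw [← e]; simp) (by simp +contextual)
    -- The last letter of the image of `X` and the first of that of `Y` are adjacent, and recur
    -- later around the image of `r`.
    obtain ⟨b, hb, hb'⟩ := H.pair (p' ++ (p.flatMap f ++ X₂)) d₃ d₄
      (Y₁ ++ (q.flatMap f ++ X₂)) (r.flatMap f) (Y₁ ++ (v.flatMap f ++ q')) (by
        rw [← e, hX', hY']; simp)
    exact hr b hb hb'
  · intro e
    have hr := mult (p' ++ p.flatMap f) (f Y ++ (d₁ :: X₁)) (by rw [← e]; simp) (by simp +contextual)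
    -- Now the last letter of the image of `Y` meets the first of that of `X`, and they recur in
    -- reverse order; the rests of the two images in between consist of repeated letters.
    obtain ⟨b, hb, hb'⟩ := H.pair' (p' ++ (p.flatMap f ++ Y₂)) d₂ d₁
      (X₁ ++ q.flatMap f) (X₁ ++ (r.flatMap f ++ Y₂)) (v.flatMap f ++ q') (by
        rw [← e, hY]; simp)
    simp only [List.mem_append] at hb
    rcases hb with hb | hb | hb
    · refine two_le_count (p := p' ++ (p.flatMap f ++ f Y)) (l := d₁ :: X₁) (m := q.flatMap f)
        (k := d₁ :: X₁) (by simp [hb]) (by simp [hb]) (by rw [← e]; simp; rfl) hb'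
    · exact hr b hb hb'
    · refine two_le_count (p := p' ++ p.flatMap f) (l := f Y)
        (m := (d₁ :: X₁) ++ (q.flatMap f ++ ((d₁ :: X₁) ++ r.flatMap f)))
        (k := f Y) (by simp [hY, hb]) (by simp [hY, hb]) (by rw [← e]; simp; rfl) hb'

/-- Words with separated letters are isoterms for `A'`. -/
theorem exists_mem_A' {W : List β} (H : Separated W) (H' : Separated W.reverse) :
    ∃ (M : Type u) (_ : Monoid M), A'.Mem M ∧ ∀ e, Satisfies M e ↔ Has (factorRel W) e := by
  obtain ⟨M, hM, h⟩ := (factorRel_fic W).exists_monoid.{u}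
  refine ⟨M, hM, (mem_A'_iff M).2 fun e he => (h e).2 ?_, h⟩
  refine has_a'Identities (factorRel_aIdentities H) (has_w (factorRel_collect H))
    (has_c fun p X Y q r v _ => factorRel_exchange H p X Y q r v)
    (has_c fun p X Y q r v _ hm => ?_) e he
  exact factorRel_reverse (factorRel_exchange H' p X Y q r v hm)

/-- Separation in terms of bounded positions and gap lengths, so that it can be decided for a
concrete word. -/
theorem separated_of_forall {W : List β}
    (h₁ : ∀ i < W.length, ∀ l < W.length, W[i]? = W[i + 1 + l]? → i + 1 + l < W.length →
      (((W.drop (i + 1)).take l).any fun b => W.count b == 1) = true)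
    (h₂ : ∀ i < W.length, ∀ k < W.length, ∀ l < W.length, i + k + l + 3 < W.length →
      ((W[i]? = W[i + k + 2]? ∧ W[i + 1]? = W[i + k + l + 3]?) ∨
        (W[i + 1]? = W[i + k + 2]? ∧ W[i]? = W[i + k + l + 3]?)) →
      (((W.drop (i + k + 3)).take l).any fun b => W.count b == 1) = true) : Separated W := by
  have key : ∀ p e f k g m h q, W = p ++ e :: f :: (k ++ g :: (m ++ h :: q)) →
      ((e = g ∧ f = h) ∨ (f = g ∧ e = h)) → ∃ b ∈ m, W.count b = 1 := by
    intro p e f k g m h q hW hcase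
    have hl : W.length = p.length + k.length + m.length + q.length + 4 := by
      rw [hW]; simp; omega
    have e₁ : W[p.length]? = some e := by rw [hW]; simp
    have e₂ : W[p.length + 1]? = some f := by rw [hW]; simp
    have e₃ : W[p.length + k.length + 2]? = some g := by
      rw [hW, show p ++ e :: f :: (k ++ g :: (m ++ h :: q)) =
        (p ++ e :: f :: k) ++ g :: (m ++ h :: q) by simp,
        List.getElem?_append_right (by simp; omega)]
      simp; rw [show p.length + k.length + 2 - (p.length + (k.length + 1 + 1)) = 0 by omega]; rfl
    have e₄ : W[p.length + k.length + m.length + 3]? = some h := by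
      rw [hW, show p ++ e :: f :: (k ++ g :: (m ++ h :: q)) =
        (p ++ e :: f :: (k ++ g :: m)) ++ h :: q by simp,
        List.getElem?_append_right (by simp; omega)]
      simp
      rw [show p.length + k.length + m.length + 3 -
        (p.length + (k.length + (m.length + 1) + 1 + 1)) = 0 by omega]; rfl
    have e₅ : (W.drop (p.length + k.length + 3)).take m.length = m := by
      rw [hW, show p ++ e :: f :: (k ++ g :: (m ++ h :: q)) =
        (p ++ e :: f :: (k ++ [g])) ++ (m ++ h :: q) by simp,
        List.drop_left' (by simp; omega), List.take_left]
    have := h₂ p.length (by omega) k.length (by omega) m.length (by omega) (by omega) (by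
      rw [e₁, e₂, e₃, e₄]
      rcases hcase with ⟨rfl, rfl⟩ | ⟨rfl, rfl⟩
      · exact Or.inl ⟨rfl, rfl⟩
      · exact Or.inr ⟨rfl, rfl⟩)
    simpa [e₅] using this
  refine ⟨?_, fun p e f k m q hW => key p e f k e m f q hW (Or.inl ⟨rfl, rfl⟩),
    fun p e f k m q hW => key p e f k f m e q hW (Or.inr ⟨rfl, rfl⟩)⟩
  intro p e m q hW
  have hl : W.length = p.length + m.length + q.length + 2 := by rw [hW]; simp; omega
  have e₁ : W[p.length]? = some e := by rw [hW]; simp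
  have e₂ : W[p.length + 1 + m.length]? = some e := by
    rw [hW, show p ++ e :: (m ++ e :: q) = (p ++ e :: m) ++ e :: q by simp,
      List.getElem?_append_right (by simp; omega)]
    simp
    rw [show p.length + 1 + m.length - (p.length + (m.length + 1)) = 0 by omega]; rfl
  have e₅ : (W.drop (p.length + 1)).take m.length = m := by
    rw [hW, show p ++ e :: (m ++ e :: q) = (p ++ [e]) ++ (m ++ e :: q) by simp,
      List.drop_left' (by simp), List.take_left]
  have := h₁ p.length (by omega) m.length (by omega) (by rw [e₁, e₂]) (by omega)
  simpa [e₅] using this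

end Isoterms

theorem not_A'_le_of_separated {W : List (Fin 4)} (H : Separated W) (H' : Separated W.reverse)
    {V : MonoidVariety.{u}} {e : Identity} (hV : Has V.rel e) (he : ¬ Has (factorRel W) e) :
    ¬ A' ≤ V := by
  intro hle
  obtain ⟨M, hM, hmem, h⟩ := exists_mem_A'.{u} H H'
  exact he ((h e).1 (hV M (hle M hmem)))

/-- The substitution `x ↦ 0`, `y ↦ 1`, `s ↦ 2`, and `3` for all other letters. -/
def toFin4 : Letter → List (Fin 4)
  | Letter.x => [0]
  | Letter.y => [1]
  | Letter.s => [2]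
  | _ => [3]

-- The word is xsxyty, the left side of σ₃, with x, y, s, t coded by 0, 1, 2, 3; σ₃ would identify
-- it with a different word.
set_option synthInstance.maxSize 1000 in
set_option synthInstance.maxHeartbeats 200000 in
theorem not_A'_le_Q (i j : Fin 3) : ¬ A'.{u} ≤ Q i j := by
  refine not_A'_le_of_separated (W := [0, 2, 0, 1, 3, 1])
    (separated_of_forall (by decide) (by decide)) (separated_of_forall (by decide) (by decide))
    (e := sigma₃) (rel_var (Or.inl (Or.inl (Or.inl (Or.inl (Or.inr rfl)))))) fun h => ?_
  have := (h toFin4 [] []).1 rfl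
  exact absurd this (by decide)

-- The same argument with xysxty, the left side of σ₁.
set_option synthInstance.maxSize 1000 in
set_option synthInstance.maxHeartbeats 200000 in
theorem not_A'_le_R : ¬ A'.{u} ≤ R := by
  refine not_A'_le_of_separated (W := [0, 1, 2, 0, 3, 1])
    (separated_of_forall (by decide) (by decide)) (separated_of_forall (by decide) (by decide))
    (e := sigma₁) (rel_var (Or.inl (Or.inr (Or.inl rfl)))) fun h => ?_
  have := (h toFin4 [] []).1 rfl
  exact absurd this (by decide)

end MonVar

open MonVar in
theorem mainTheorem7 :
    (∀ X Y Z : MonoidVariety.Sub A'.{u}, X ⊓ (Y ⊔ Z) = (X ⊓ Y) ⊔ (X ⊓ Z)) ∧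
    (∀ r s : Fin 3, Q.{u} r s < A'.{u}) ∧
    R.{u} < A'.{u} := by
  refine ⟨fun X Y Z => le_antisymm (inf_sup_le X.2 Y.2 Z.2) le_inf_sup, fun i j => ?_, ?_⟩
  · exact lt_of_le_not_ge (Q_le i j) (not_A'_le_Q i j)
  · exact lt_of_le_not_ge R_le not_A'_le_R
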